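/- **Setting.** Let $\mu$ be the Haar probability measure on $SO(3)$, $\omega(x)=\arccos\frac{\operatorname{tr}x-1}{2}\in[0,\pi]$ the rotation angle, and $\mathrm{dist}(x,y)=\omega(y^{-1}x)$. Let $X_0,X_1,X_2$ be the left-invariant vector fields $X_if(x)=\frac{d}{dt}f(x\,e^{tE_i})|_{t=0}$, where $e^{tE_i}$ is the rotation by $t$ about the $i$-th coordinate axis, and let $\Delta=-(X_0^2+X_1^2+X_2^2)$ be the (nonnegative) Laplace–Beltrami operator. Its eigenvalues are $\ell(\ell+1)$, $\ell=0,1,2,\dots$; let $\mathcal H_\ell$ be the eigenspace of $\ell(\ell+1)$ and $\Pi_L=\bigoplus_{\ell\le L}\mathcal H_\ell$ the polynomials of degree at most $L$. Functions are complex valued, and $\|\cdot\|_p$ is the norm of $L_p(SO(3),\mu)$. *Smoothness spaces.* For $1\le p<\infty$, $W_p^k$ is the space of $f\in L_p$ all of whose weak derivatives $X_{i_1}\cdots X_{i_r}f$ with $r\le k$ are in $L_p$, and $\|f\|_{W_p^k}^p=\sum_{r\le k}\sum_{i_1,\dots,i_r}\|X_{i_1}\cdots X_{i_r}f\|_p^p$.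 (This norm is equivalent to the one obtained by transporting the Euclidean Sobolev norm through a finite smooth partition of unity and corresponding charts.) For $p=\infty$ read $W_\infty^k:=C^k(SO(3))$ with the maximum of the uniform norms of these derivatives. Fix $m\ge 2$. For $0<s<2m$ and $1\le p\le\infty$, the Besov space $B^s_{p,\infty}(SO(3))$ consists of the $f\in L_p$ (of the $f\in C(SO(3))$ if $p=\infty$) with $$\|f\|_{B^s_{p,\infty}}:=\sup_{t>0}t^{-s}K(f,t)<\infty,\qquad K(f,t):=\inf\{\|f-g\|_p+t^{2m}\|g\|_{W_p^{2m}}: g\in W_p^{2m}\}.$$ *Kernel and scheme.* Let $k_m(x,\alpha)=\bigl(\sin\tfrac{\omega(\alpha^{-1}x)}{2}\bigr)^{2m-3}$ and $\mathcal L_m=\frac{\pi(-4)^{m-1}}{(2m-2)!}\prod_{j=0}^{m-1}\bigl(\Delta-(j^2-\tfrac14)\bigr)$. A coefficient kernel on a finite set $\Xi\subset SO(3)$ is a map $a:\Xi\times SO(3)\to\mathbb R$, measurable in the second variable. It satisfies the coefficient kernel conditions (CKCs) with radius $\rho>0$, precision $L$ and stability constant $K\ge1$ if 1. $a(\xi,\alpha)=0$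 whenever $\mathrm{dist}(\alpha,\xi)>\rho$; 2. $\sum_{\xi\in\Xi}a(\xi,\alpha)q(\xi)=q(\alpha)$ for all $q\in\Pi_L$ and $\alpha\in SO(3)$; 3. $\sum_{\xi\in\Xi}|a(\xi,\alpha)|\le K$ for all $\alpha\in SO(3)$. For $g\in W_p^{2m}$ put $T_\Xi g=\sum_{\xi\in\Xi}A_\xi k_m(\cdot,\xi)$ with $A_\xi=\int_{SO(3)}\mathcal L_mg(\alpha)\,a(\xi,\alpha)\,d\mu(\alpha)$, where $\mathcal L_m g$ is taken in the weak sense. **Theorem.** Let $m\ge2$, $L\ge2m$ and $K$ be given. There is a constant $C>0$, depending only on $m$, $L$ and $K$, such that for all $0<s<2m$, all $1\le p\le\infty$, every finite $\Xi\subset SO(3)$, every coefficient kernel $a:\Xi\times SO(3)\to\mathbb R$ satisfying the CKCs with radius $\rho>0$, precision $L$ and stability constant $K$, and every $f\in B^s_{p,\infty}(SO(3))$, the following holds. There is $g_\rho\in W_p^{2m}$ with $$\|g_\rho\|_{W_p^{2m}}\le2\rho^{s-2m}\|f\|_{B^s_{p,\infty}}\quad\text{and}\quad\|f-g_\rho\|_p\le2\rho^{s}\|f\|_{B^s_{p,\infty}},$$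 and for every such $g_\rho$ the approximant $s_{f,\Xi}:=T_\Xi g_\rho$ satisfies $$\|f-s_{f,\Xi}\|_p\le C\rho^s\|f\|_{B^s_{p,\infty}}.$$ -/

import Mathlib

open MeasureTheory
open scoped ENNReal

noncomputable section

namespace SurfaceSpline

/-! ### The rotation group -/

/-- The rotation group `SO(3)`: real orthogonal `3 × 3` matrices of determinant one, with the
topology of entrywise convergence. -/
abbrev SO3 : Type := Matrix.specialOrthogonalGroup (Fin 3) ℝ

theorem SO3.mul_transpose (x : SO3) : x.1 * x.1.transpose = 1 := by
  have h := (Matrix.mem_specialOrthogonalGroup_iff.1 x.2).1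
  exact (Matrix.mem_orthogonalGroup_iff (Fin 3) ℝ).1 h

instance : IsTopologicalGroup SO3 where
  continuous_mul := by
    refine Continuous.subtype_mk ?_ _
    exact (continuous_subtype_val.comp continuous_fst).mul
      (continuous_subtype_val.comp continuous_snd)
  continuous_inv := by
    refine Continuous.subtype_mk ?_ _
    exact (continuous_subtype_val (p := fun y : Matrix (Fin 3) (Fin 3) ℝ =>
      y ∈ Matrix.specialOrthogonalGroup (Fin 3) ℝ)).matrix_transpose

instance : CompactSpace SO3 := by
  have hset : ((Matrix.specialOrthogonalGroup (Fin 3) ℝ : Submonoid _) :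
      Set (Matrix (Fin 3) (Fin 3) ℝ)) = {A | A * A.transpose = 1 ∧ A.det = 1} := by
    ext A
    rw [SetLike.mem_coe, Matrix.mem_specialOrthogonalGroup_iff]
    exact and_congr (Matrix.mem_orthogonalGroup_iff (Fin 3) ℝ) Iff.rfl
  have hclosed : IsClosed {A : Matrix (Fin 3) (Fin 3) ℝ | A * A.transpose = 1 ∧ A.det = 1} :=
    (isClosed_eq (continuous_id.mul continuous_id.matrix_transpose) continuous_const).inter
      (isClosed_eq continuous_id.matrix_det continuous_const)
  have hbox : IsCompact (Set.univ.pi fun _ : Fin 3 => Set.univ.pi fun _ : Fin 3 =>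
      Set.Icc (-1 : ℝ) 1) :=
    isCompact_univ_pi fun _ => isCompact_univ_pi fun _ => isCompact_Icc
  have hsub : {A : Matrix (Fin 3) (Fin 3) ℝ | A * A.transpose = 1 ∧ A.det = 1} ⊆
      (Set.univ.pi fun _ : Fin 3 => Set.univ.pi fun _ : Fin 3 => Set.Icc (-1 : ℝ) 1) := by
    intro A hA i _ j _
    have h := congrFun (congrFun hA.1 i) i
    simp only [Matrix.mul_apply, Matrix.transpose_apply, Matrix.one_apply_eq] at h
    have h2 : A i j * A i j ≤ ∑ k, A i k * A i k :=
      Finset.single_le_sum (f := fun k => A i k * A i k) (fun k _ => mul_self_nonneg _)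
        (Finset.mem_univ j)
    exact ⟨by nlinarith, by nlinarith⟩
  have hc := hbox.of_isClosed_subset hclosed hsub
  rw [← hset] at hc
  exact isCompact_iff_compactSpace.1 hc

instance : MeasurableSpace SO3 := borel SO3

instance : BorelSpace SO3 := ⟨rfl⟩

/-- The Haar measure of `SO(3)`, normalized to total mass one. -/
def μ : Measure SO3 := Measure.haarMeasure ⊤

instance : IsProbabilityMeasure μ :=
  ⟨by simpa [μ] using
    Measure.haarMeasure_self (K₀ := (⊤ : TopologicalSpace.PositiveCompacts SO3))⟩

/-- The rotation angle `ω(x) ∈ [0, π]`, determined by `tr x = 1 + 2 cos ω(x)`. -/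
def angle (x : SO3) : ℝ := Real.arccos ((x.1.trace - 1) / 2)

/-- The translation invariant distance `dist(x, y) = ω(y⁻¹ x)`. -/
def rotDist (x y : SO3) : ℝ := angle (y⁻¹ * x)

/-! ### Differentiation along left-invariant vector fields -/

/-- The matrix of the rotation by the angle `t` about the `i`-th coordinate axis. -/
def rotMatrix (i : Fin 3) (t : ℝ) : Matrix (Fin 3) (Fin 3) ℝ :=
  ![!![1, 0, 0; 0, Real.cos t, -Real.sin t; 0, Real.sin t, Real.cos t],
    !![Real.cos t, 0, Real.sin t; 0, 1, 0; -Real.sin t, 0, Real.cos t],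
    !![Real.cos t, -Real.sin t, 0; Real.sin t, Real.cos t, 0; 0, 0, 1]] i

theorem rotMatrix_mem (i : Fin 3) (t : ℝ) :
    rotMatrix i t ∈ Matrix.specialOrthogonalGroup (Fin 3) ℝ := by
  have h := Real.sin_sq_add_cos_sq t
  rw [Matrix.mem_specialOrthogonalGroup_iff]
  refine ⟨(Matrix.mem_orthogonalGroup_iff (Fin 3) ℝ).2 ?_, ?_⟩
  · change rotMatrix i t * (rotMatrix i t).transpose = 1
    ext a b
    fin_cases i <;> fin_cases a <;> fin_cases b <;>
      simp [rotMatrix, Matrix.mul_apply, Fin.sum_univ_three] <;> linarith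
  · fin_cases i <;> simp [rotMatrix, Matrix.det_fin_three] <;> linarith

/-- The rotation by the angle `t` about the `i`-th coordinate axis: the three one-parameter
subgroups `t ↦ exp (t Eᵢ)` belonging to the standard basis `E₀, E₁, E₂` of the Lie algebra. -/
def rot (i : Fin 3) (t : ℝ) : SO3 := ⟨rotMatrix i t, rotMatrix_mem i t⟩

/-- The left-invariant vector field `Xᵢ`, acting on functions:
`Xᵢ f (x) = d/dt f (x exp (t Eᵢ))` at `t = 0`. The fields `X₀, X₁, X₂` form an orthonormal frame
of the Riemannian metric whose distance is `rotDist`. -/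
def X (i : Fin 3) (f : SO3 → ℂ) : SO3 → ℂ := fun x => deriv (fun t : ℝ => f (x * rot i t)) 0

/-- The iterated derivative `X_{i₁} X_{i₂} ⋯ X_{iᵣ} f` along the word `[i₁, …, iᵣ]`. -/
def XWord (w : List (Fin 3)) (f : SO3 → ℂ) : SO3 → ℂ := w.foldr X f

/-- `f` is of class `C^k` on the compact submanifold `SO(3)` of `ℝ^{3 × 3}`, that is, `f` is the
restriction of a `C^k` function of the nine matrix entries. -/
def IsCk (k : ℕ∞) (f : SO3 → ℂ) : Prop :=
  ∃ F : (Fin 3 → Fin 3 → ℝ) → ℂ, ContDiff ℝ k F ∧ ∀ x : SO3, f x = F x.1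

/-- `C^∞` functions on `SO(3)`. -/
def IsSmooth (f : SO3 → ℂ) : Prop := IsCk ⊤ f

/-- The Laplace–Beltrami operator `Δ = -(X₀² + X₁² + X₂²)`, with the sign that makes it
nonnegative, so that its eigenvalues are the numbers `ℓ (ℓ + 1)`. -/
def laplacian (f : SO3 → ℂ) : SO3 → ℂ := fun x => -∑ i, X i (X i f) x

/-- The space `Π_L = H_0 ⊕ ⋯ ⊕ H_L` of polynomials of degree at most `L`, where `H_ℓ` is the
eigenspace of `Δ` for the eigenvalue `ℓ (ℓ + 1)`. -/
def polynomials (L : ℕ) : Submodule ℂ (SO3 → ℂ) :=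
  Submodule.span ℂ {p | IsSmooth p ∧
    ∃ ℓ : ℕ, ℓ ≤ L ∧ ∀ x, laplacian p x = (ℓ : ℂ) * ((ℓ : ℂ) + 1) * p x}

/-! ### Weak derivatives, Sobolev and Besov spaces -/

/-- `u` is the weak derivative of `f` along the word `w = [i₁, …, iᵣ]`. Each `Xᵢ` is skew-adjoint
with respect to Haar measure, so the formal adjoint of `X_{i₁} ⋯ X_{iᵣ}` is
`(-1)^r X_{iᵣ} ⋯ X_{i₁}`. -/
def IsWeakDeriv (w : List (Fin 3)) (f u : SO3 → ℂ) : Prop :=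
  ∀ φ : SO3 → ℂ, IsSmooth φ →
    ∫ x, f x * XWord w.reverse φ x ∂μ = (-1) ^ w.length * ∫ x, u x * φ x ∂μ

open Classical in
/-- The weak derivative of `f` along the word `w`, when there is an integrable one (it is then
unique up to null sets); zero otherwise. -/
def weakDeriv (w : List (Fin 3)) (f : SO3 → ℂ) : SO3 → ℂ :=
  if h : ∃ u, Integrable u μ ∧ IsWeakDeriv w f u then h.choose else 0

/-- Membership in the space `W_p^k(SO(3))`: for `p < ∞`, functions in `L_p` all of whose weak
derivatives of order at most `k` exist and lie in `L_p`; for `p = ∞`, the space `C^k(SO(3))`. -/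
def MemW (p : ℝ≥0∞) (k : ℕ) (f : SO3 → ℂ) : Prop :=
  if p = ∞ then IsCk k f
  else MemLp f p μ ∧
    ∀ w : List (Fin 3), w.length ≤ k → ∃ u, MemLp u p μ ∧ IsWeakDeriv w f u

/-- The norm of `W_p^k(SO(3))`: the `ℓ_p`-sum of the `L_p` norms of all derivatives of order at
most `k`, and the largest uniform norm of these derivatives when `p = ∞`. -/
def normW (p : ℝ≥0∞) (k : ℕ) (f : SO3 → ℂ) : ℝ≥0∞ :=
  if p = ∞ then ⨆ w : List (Fin 3), ⨆ _ : w.length ≤ k, ⨆ x : SO3, ‖XWord w f x‖ₑ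
  else (∑ r ∈ Finset.range (k + 1), ∑ w : Fin r → Fin 3,
    eLpNorm (weakDeriv (List.ofFn w) f) p μ ^ p.toReal) ^ (1 / p.toReal)

/-- Membership in `L_p(SO(3))` for `p < ∞`, and in `C(SO(3))` for `p = ∞`. -/
def MemBase (p : ℝ≥0∞) (f : SO3 → ℂ) : Prop :=
  if p = ∞ then Continuous f else MemLp f p μ

/-- The `K`-functional of the pair `L_p`, `W_p^k` (of `C`, `C^k` when `p = ∞`), with the weight
`t ^ k` on the second norm. -/
def kFunctional (p : ℝ≥0∞) (k : ℕ) (f : SO3 → ℂ) (t : ℝ) : ℝ≥0∞ :=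
  ⨅ (g : SO3 → ℂ) (_ : MemW p k g),
    eLpNorm (fun x => f x - g x) p μ + ENNReal.ofReal (t ^ k) * normW p k g

/-- The norm of the Besov space `B^s_{p,∞}(SO(3))`, defined through the `K`-functional of order
`2m`. -/
def normB (m : ℕ) (s : ℝ) (p : ℝ≥0∞) (f : SO3 → ℂ) : ℝ≥0∞ :=
  ⨆ (t : ℝ) (_ : 0 < t), ENNReal.ofReal (t ^ (-s)) * kFunctional p (2 * m) f t

/-- Membership in the Besov space `B^s_{p,∞}(SO(3))`. -/
def MemB (m : ℕ) (s : ℝ) (p : ℝ≥0∞) (f : SO3 → ℂ) : Prop :=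
  MemBase p f ∧ normB m s p f < ∞

/-! ### Surface splines and the approximation scheme -/

/-- The surface spline kernel `k_m(x, α) = sin (ω(α⁻¹ x) / 2) ^ (2m - 3)`, for `m ≥ 2`. -/
def kernel (m : ℕ) (x α : SO3) : ℝ := Real.sin (angle (α⁻¹ * x) / 2) ^ (2 * m - 3)

/-- The product `∏_{j < n} (Δ - r_j)` applied to `f`, where `r_j = j² - 1/4`. -/
def shiftedLaplacians : ℕ → (SO3 → ℂ) → SO3 → ℂ
  | 0, f => f
  | n + 1, f => fun x => laplacian (shiftedLaplacians n f) x
      - ((n : ℂ) ^ 2 - 1 / 4) * shiftedLaplacians n f x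

/-- The differential operator `𝓛_m = (π (-4)^(m-1) / (2m-2)!) ∏_{j=0}^{m-1} (Δ - r_j)` of order
`2m` on smooth functions. -/
def opL (m : ℕ) (f : SO3 → ℂ) : SO3 → ℂ := fun x =>
  ((Real.pi : ℂ) * (-4) ^ (m - 1) / ((2 * m - 2).factorial : ℂ)) * shiftedLaplacians m f x

/-- `u` is `𝓛_m f` in the weak sense; `𝓛_m` is formally self-adjoint. -/
def IsWeakL (m : ℕ) (f u : SO3 → ℂ) : Prop :=
  ∀ φ : SO3 → ℂ, IsSmooth φ → ∫ x, f x * opL m φ x ∂μ = ∫ x, u x * φ x ∂μ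

open Classical in
/-- The function `𝓛_m f` for `f ∈ W_p^{2m}(SO(3))`, taken in the weak sense (it is then unique up
to null sets); zero if there is no such integrable function. -/
def weakL (m : ℕ) (f : SO3 → ℂ) : SO3 → ℂ :=
  if h : ∃ u, Integrable u μ ∧ IsWeakL m f u then h.choose else 0

/-- The coefficient kernel conditions for `a : Ξ × SO(3) → ℝ` with radius `ρ`, precision `L` and
stability constant `K`. -/
structure CoefficientKernel (Ξ : Finset SO3) (a : Ξ → SO3 → ℝ) (ρ : ℝ) (L : ℕ) (K : ℝ) :
    Prop where
  measurable : ∀ ξ, Measurable (a ξ)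
  support : ∀ (ξ : Ξ) (α : SO3), ρ < rotDist α ξ → a ξ α = 0
  precision : ∀ p ∈ polynomials L, ∀ α : SO3, ∑ ξ : Ξ, (a ξ α : ℂ) * p ξ = p α
  one_le : 1 ≤ K
  stability : ∀ α : SO3, ∑ ξ : Ξ, |a ξ α| ≤ K

/-- The approximation operator `T_Ξ g = ∑_ξ A_ξ k_m(·, ξ)` with the coefficients
`A_ξ = ∫ 𝓛_m g(α) a(ξ, α) dμ(α)`. -/
def approximant (m : ℕ) (Ξ : Finset SO3) (a : Ξ → SO3 → ℝ) (g : SO3 → ℂ) : SO3 → ℂ := fun x =>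
  ∑ ξ : Ξ, (∫ α, weakL m g α * (a ξ α : ℂ) ∂μ) * (kernel m x ξ : ℂ)

/-- `g` is an admissible smooth part `g_ρ` of `f ∈ B^s_{p,∞}(SO(3))` at scale `ρ`:
`g ∈ W_p^{2m}`, `‖g‖_{W_p^{2m}} ≤ 2 ρ^(s-2m) ‖f‖_B` and `‖f - g‖_p ≤ 2 ρ^s ‖f‖_B`. -/
structure IsSmoothPart (m : ℕ) (s : ℝ) (p : ℝ≥0∞) (ρ : ℝ) (f g : SO3 → ℂ) : Prop where
  mem : MemW p (2 * m) g
  normW_le : normW p (2 * m) g ≤ ENNReal.ofReal (2 * ρ ^ (s - 2 * (m : ℝ))) * normB m s p f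
  norm_sub_le : eLpNorm (fun x => f x - g x) p μ ≤ ENNReal.ofReal (2 * ρ ^ s) * normB m s p f

end SurfaceSpline

end

/-!
The error of the scheme is `f - T g = (f - g) + (g - T g)`, and the definition of the Besov norm
through the `K`-functional provides a smooth part `g` for which the first term is of the right
size. Everything else is the estimate `‖g - T g‖_p ≤ C ρ^(2m) ‖g‖_{W_p^{2m}}`, where `T` is the
approximation operator (`exists_eLpNorm_sub_approximant_le`).

The radial variable throughout is `sinSq x = sin² (ω(x) / 2) = (3 - tr x) / 4`. For `α`, `x` in
`SO(3)`, the number `sinSq (α⁻¹ x)` is an eighth of the squared Frobenius distance of `x` and `α`;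
hence its square root `chord` satisfies the triangle inequality, and for fixed `x` it is an affine
function of the entries of `α`.

*Green function.* On radial functions the Laplacian is an ordinary differential operator in
`sinSq`, which sends `sinSq ^ b` to a combination of `sinSq ^ b` and `sinSq ^ (b - 1)`. The factors
of `𝓛_m` therefore lower the exponent of the kernel `sinSq ^ (m - 3/2)` one by one, down to
`sinSq ^ (-1/2)`, which the last factor `Δ + 1/4` turns into a point mass
(`integral_splineProfile_mul_opL`). The size of the point mass comes from Weyl's integration formula
for functions of the angle (`map_sinSq`), obtained from the moments of `sinSq`, which satisfy a
recursion because `∫ Δ (sinSq ^ n) = 0`. Since `𝓛_m` commutes with left translations and the kernel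
is a class function, convolution with the kernel inverts `𝓛_m` on polynomials, and by duality
`g = ∫ 𝓛_m g(α) k_m(·, α) dμ(α)` for every `g ∈ W_p^{2m}` (`ae_eq_integral_kernel`).

*Error kernel.* Consequently `g - T g = ∫ 𝓛_m g(α) E(·, α) dμ(α)`, where
`E(x, α) = k_m(x, α) - ∑_ξ a(ξ, α) k_m(x, ξ)`. For `x` at distance comparable to `ρ` from `α` every
term of `E` is `O(ρ^(2m-3))`. Farther away, the kernel is a power of a quantity affine in the
entries of `ξ`; its binomial expansion about `α`, cut off after degree `2m`, is a polynomial of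
degree `2m` in these entries, hence belongs to `Π_{2m}` (`entryPoly_le_polynomials`) and is
reproduced by the coefficients. The remainder gives `|E| ≤ C ρ^(2m+1) / (sinSq (α⁻¹ x) + ρ²)²`
(`exists_errorKernel_le`), a convolution kernel of `L_1` norm `O(ρ^(2m))`, and Young's inequality
together with `‖𝓛_m g‖_p ≤ C ‖g‖_{W_p^{2m}}` (`exists_eLpNorm_weakL_le`) concludes.

That polynomials of degree `n` in the matrix entries lie in `Π_n` follows by induction:
`Δ - n (n + 1)` lowers the degree on them, because `Δ` acts on the top degree part by exchanging
column indices, and the `2 × 2` minors of a rotation are single entries.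
-/

namespace SurfaceSpline

/-! ### Differentiation along the coordinate rotations -/

/-- The generator `Eᵢ` of the rotations about the `i`-th axis: the derivative of `rotMatrix i`
at `0`. -/
def rotGen (i : Fin 3) : Matrix (Fin 3) (Fin 3) ℝ :=
  ![!![0, 0, 0; 0, 0, -1; 0, 1, 0], !![0, 0, 1; 0, 0, 0; -1, 0, 0],
    !![0, -1, 0; 1, 0, 0; 0, 0, 0]] i

theorem hasDerivAt_rotMatrix (i c b : Fin 3) :
    HasDerivAt (fun t => rotMatrix i t c b) (rotGen i c b) 0 := by
  have hs : HasDerivAt Real.sin 1 0 := by simpa using Real.hasDerivAt_sin 0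
  have hc : HasDerivAt Real.cos 0 0 := by simpa using Real.hasDerivAt_cos 0
  have hs' : HasDerivAt (fun t => -Real.sin t) (-1) 0 := hs.neg
  fin_cases i <;> fin_cases c <;> fin_cases b <;> simp [rotMatrix, rotGen] <;>
    first | exact hs | exact hc | exact hs' | exact hasDerivAt_const _ _

theorem rot_zero (i : Fin 3) : rot i 0 = 1 := by
  apply Subtype.ext
  ext a b
  fin_cases i <;> fin_cases a <;> fin_cases b <;> simp [rot, rotMatrix]

theorem rot_add (i : Fin 3) (s t : ℝ) : rot i (s + t) = rot i s * rot i t := by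
  apply Subtype.ext
  ext a b
  fin_cases i <;> fin_cases a <;> fin_cases b <;>
    simp [rot, rotMatrix, Real.sin_add, Real.cos_add] <;>
    ring

/-- `f` is differentiable along `Xᵢ` at every point, with derivative `f'`. -/
def HasX (i : Fin 3) (f f' : SO3 → ℂ) : Prop :=
  ∀ x, HasDerivAt (fun t : ℝ => f (x * rot i t)) (f' x) 0

namespace HasX

variable {i : Fin 3} {f g f' g' : SO3 → ℂ}

theorem X_eq (h : HasX i f f') : X i f = f' := funext fun x => (h x).deriv

theorem add (hf : HasX i f f') (hg : HasX i g g') :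
    HasX i (fun x => f x + g x) (fun x => f' x + g' x) := fun x => (hf x).add (hg x)

theorem const_mul (c : ℂ) (hf : HasX i f f') :
    HasX i (fun x => c * f x) (fun x => c * f' x) := fun x => (hf x).const_mul c

theorem mul (hf : HasX i f f') (hg : HasX i g g') :
    HasX i (fun x => f x * g x) (fun x => f' x * g x + f x * g' x) := fun x => by
  simpa [rot_zero] using (hf x).fun_mul (hg x)

theorem sum {ι : Type*} {s : Finset ι} {F F' : ι → SO3 → ℂ} (h : ∀ j ∈ s, HasX i (F j) (F' j)) :
    HasX i (fun x => ∑ j ∈ s, F j x) (fun x => ∑ j ∈ s, F' j x) := fun x =>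
  HasDerivAt.fun_sum fun j hj => h j hj x

/-- Differentiability at `t = 0` along every left coset of the one-parameter group gives
differentiability at all times. -/
theorem hasDerivAt (h : HasX i f f') (x : SO3) (t : ℝ) :
    HasDerivAt (fun t : ℝ => f (x * rot i t)) (f' (x * rot i t)) t := by
  have h1 := h (x * rot i t)
  have h2 : (fun s : ℝ => f (x * rot i t * rot i s)) = fun s => f (x * rot i (t + s)) := by
    funext s
    rw [rot_add, mul_assoc]
  rw [h2] at h1
  have h3 : HasDerivAt (fun s : ℝ => s - t) 1 t := (hasDerivAt_id t).sub_const t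
  have h4 := HasDerivAt.scomp_of_eq t h1 h3 (sub_self t).symm
  simpa [Function.comp_def] using h4

end HasX

/-! ### Smooth functions -/

theorem continuous_coe_matrix :
    Continuous fun x : SO3 => (x.1 : Fin 3 → Fin 3 → ℝ) := continuous_subtype_val

namespace IsCk

variable {k l : ℕ∞} {f g : SO3 → ℂ}

theorem of_le (hf : IsCk k f) (h : l ≤ k) : IsCk l f := by
  obtain ⟨F, hF, hf⟩ := hf
  exact ⟨F, hF.of_le (by exact_mod_cast h), hf⟩

theorem continuous (hf : IsCk k f) : Continuous f := by
  obtain ⟨F, hF, hf⟩ := hf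
  rw [show f = fun x => F x.1 from funext hf]
  exact hF.continuous.comp continuous_coe_matrix

theorem const (c : ℂ) : IsCk k fun _ => c := ⟨fun _ => c, contDiff_const, fun _ => rfl⟩

theorem add (hf : IsCk k f) (hg : IsCk k g) : IsCk k fun x => f x + g x := by
  obtain ⟨F, hF, hf⟩ := hf
  obtain ⟨G, hG, hg⟩ := hg
  exact ⟨fun A => F A + G A, hF.add hG, fun x => congrArg₂ (· + ·) (hf x) (hg x)⟩

theorem mul (hf : IsCk k f) (hg : IsCk k g) : IsCk k fun x => f x * g x := by
  obtain ⟨F, hF, hf⟩ := hf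
  obtain ⟨G, hG, hg⟩ := hg
  exact ⟨fun A => F A * G A, hF.mul hG, fun x => congrArg₂ (· * ·) (hf x) (hg x)⟩

theorem const_mul (c : ℂ) (hf : IsCk k f) : IsCk k fun x => c * f x := (const c).mul hf

theorem neg (hf : IsCk k f) : IsCk k fun x => -f x := by simpa using hf.const_mul (-1)

theorem sub (hf : IsCk k f) (hg : IsCk k g) : IsCk k fun x => f x - g x := by
  simpa [sub_eq_add_neg] using hf.add hg.neg

theorem sum {ι : Type*} {s : Finset ι} {F : ι → SO3 → ℂ} (h : ∀ j ∈ s, IsCk k (F j)) :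
    IsCk k (fun x => ∑ j ∈ s, F j x) := by
  classical
  induction s using Finset.induction_on with
  | empty => simpa using const 0
  | insert a s ha ih =>
    simp only [Finset.sum_insert ha]
    exact (h a (by simp)).add (ih fun j hj => h j (by simp [hj]))

/-- A `C^{k+1}` function is differentiable along `Xᵢ`, with a `C^k` derivative. -/
theorem hasX_and (hf : IsCk (k + 1) f) (i : Fin 3) : HasX i f (X i f) ∧ IsCk k (X i f) := by
  obtain ⟨F, hF, hf⟩ := hf
  have hF1 : ContDiff ℝ ((k : WithTop ℕ∞) + 1) F := by exact_mod_cast hF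
  let V : (Fin 3 → Fin 3 → ℝ) → (Fin 3 → Fin 3 → ℝ) := fun A a b => ∑ c, A a c * rotGen i c b
  have hV : ContDiff ℝ k V := by
    refine contDiff_pi.2 fun a => contDiff_pi.2 fun b => ContDiff.sum fun c _ => ?_
    exact (contDiff_apply_apply ℝ ℝ a c).mul contDiff_const
  have key : HasX i f (fun x => fderiv ℝ F x.1 (V x.1)) := by
    intro x
    rw [show (fun t : ℝ => f (x * rot i t)) = fun t => F ((x * rot i t).1) from funext fun t => hf _]
    have hp : HasDerivAt (fun t : ℝ => ((x * rot i t).1 : Fin 3 → Fin 3 → ℝ)) (V x.1) 0 := by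
      refine hasDerivAt_pi.2 fun a => hasDerivAt_pi.2 fun b => ?_
      have : (fun t : ℝ => ((x * rot i t).1 : Fin 3 → Fin 3 → ℝ) a b) =
          fun t => ∑ c, x.1 a c * rotMatrix i t c b := by
        funext t
        exact Matrix.mul_apply
      rw [this]
      exact HasDerivAt.fun_sum fun c _ => (hasDerivAt_rotMatrix i c b).const_mul _
    have hd : HasFDerivAt F (fderiv ℝ F x.1) x.1 :=
      (hF1.differentiable (by simp) x.1).hasFDerivAt
    refine HasFDerivAt.comp_hasDerivAt_of_eq 0 hd hp ?_
    exact congrArg Subtype.val (show x = x * rot i 0 by rw [rot_zero, mul_one])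
  rw [key.X_eq]
  refine ⟨key, fun A => fderiv ℝ F A (V A), ?_, fun x => rfl⟩
  exact (hF1.fderiv_right le_rfl).clm_apply hV

theorem hasX (hf : IsCk (k + 1) f) (i : Fin 3) : HasX i f (X i f) := (hf.hasX_and i).1

theorem X (hf : IsCk (k + 1) f) (i : Fin 3) : IsCk k (X i f) := (hf.hasX_and i).2

end IsCk

theorem IsSmooth.hasX {f : SO3 → ℂ} (hf : IsSmooth f) (i : Fin 3) : HasX i f (X i f) :=
  IsCk.hasX (k := ⊤) hf i

theorem IsSmooth.X {f : SO3 → ℂ} (hf : IsSmooth f) (i : Fin 3) : IsSmooth (X i f) :=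
  IsCk.X (k := ⊤) hf i

theorem IsSmooth.XWord {f : SO3 → ℂ} (hf : IsSmooth f) (w : List (Fin 3)) :
    IsSmooth (XWord w f) := by
  induction w with
  | nil => exact hf
  | cons i w ih => exact ih.X i

theorem IsSmooth.laplacian {f : SO3 → ℂ} (hf : IsSmooth f) : IsSmooth (laplacian f) :=
  IsCk.neg (IsCk.sum fun i _ => (hf.X i).X i)

theorem X_add {f g : SO3 → ℂ} (hf : IsSmooth f) (hg : IsSmooth g) (i : Fin 3) :
    X i (fun x => f x + g x) = fun x => X i f x + X i g x := ((hf.hasX i).add (hg.hasX i)).X_eq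

theorem X_const_mul {f : SO3 → ℂ} (c : ℂ) (hf : IsSmooth f) (i : Fin 3) :
    X i (fun x => c * f x) = fun x => c * X i f x := ((hf.hasX i).const_mul c).X_eq

theorem X_mul {f g : SO3 → ℂ} (hf : IsSmooth f) (hg : IsSmooth g) (i : Fin 3) :
    X i (fun x => f x * g x) = fun x => X i f x * g x + f x * X i g x :=
  ((hf.hasX i).mul (hg.hasX i)).X_eq

theorem X_sum {ι : Type*} {s : Finset ι} {F : ι → SO3 → ℂ} (h : ∀ j ∈ s, IsSmooth (F j))
    (i : Fin 3) : X i (fun x => ∑ j ∈ s, F j x) = fun x => ∑ j ∈ s, X i (F j) x :=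
  (HasX.sum fun j hj => (h j hj).hasX i).X_eq

theorem XWord_sum {ι : Type*} {s : Finset ι} {F : ι → SO3 → ℂ} (h : ∀ j ∈ s, IsSmooth (F j))
    (w : List (Fin 3)) :
    XWord w (fun x => ∑ j ∈ s, F j x) = fun x => ∑ j ∈ s, XWord w (F j) x := by
  induction w with
  | nil => rfl
  | cons i w ih =>
    change X i (XWord w _) = _
    rw [ih, X_sum fun j hj => (h j hj).XWord w]
    rfl

theorem XWord_const_mul {f : SO3 → ℂ} (c : ℂ) (hf : IsSmooth f) (w : List (Fin 3)) :
    XWord w (fun x => c * f x) = fun x => c * XWord w f x := by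
  induction w with
  | nil => rfl
  | cons i w ih =>
    change X i (XWord w _) = _
    rw [ih, X_const_mul c (hf.XWord w)]
    rfl

theorem laplacian_add {f g : SO3 → ℂ} (hf : IsSmooth f) (hg : IsSmooth g) :
    laplacian (fun x => f x + g x) = fun x => laplacian f x + laplacian g x := by
  funext x
  simp only [laplacian, X_add hf hg, X_add (hf.X _) (hg.X _), Finset.sum_add_distrib]
  ring

theorem laplacian_const_mul {f : SO3 → ℂ} (c : ℂ) (hf : IsSmooth f) :
    laplacian (fun x => c * f x) = fun x => c * laplacian f x := by
  funext x
  simp only [laplacian, X_const_mul c hf, X_const_mul c (hf.X _), ← Finset.mul_sum]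
  ring

theorem X_comp_mul_left (y : SO3) (f : SO3 → ℂ) (i : Fin 3) :
    X i (fun x => f (y * x)) = fun x => X i f (y * x) := by
  funext x
  simp only [X, mul_assoc]

theorem laplacian_comp_mul_left (y : SO3) (f : SO3 → ℂ) :
    laplacian (fun x => f (y * x)) = fun x => laplacian f (y * x) := by
  funext x
  simp only [laplacian, X_comp_mul_left y]

/-! ### Haar measure and integration by parts -/

instance : SecondCountableTopology (Matrix (Fin 3) (Fin 3) ℝ) :=
  inferInstanceAs (SecondCountableTopology (Fin 3 → Fin 3 → ℝ))

instance : TopologicalSpace.PseudoMetrizableSpace (Matrix (Fin 3) (Fin 3) ℝ) :=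
  inferInstanceAs (TopologicalSpace.PseudoMetrizableSpace (Fin 3 → Fin 3 → ℝ))

instance : SecondCountableTopology SO3 := TopologicalSpace.Subtype.secondCountableTopology _

instance : TopologicalSpace.PseudoMetrizableSpace SO3 :=
  Topology.IsInducing.subtypeVal.pseudoMetrizableSpace

instance : μ.IsHaarMeasure := inferInstanceAs (Measure.haarMeasure ⊤).IsHaarMeasure

/-- A compact group is unimodular. -/
instance : μ.IsMulRightInvariant where
  map_mul_right_eq_self g := by
    have h := Measure.haarMeasure_unique (Measure.map (· * g) μ)
      (⊤ : TopologicalSpace.PositiveCompacts SO3)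
    change _ = _ • μ at h
    rw [Measure.map_apply (measurable_mul_const g)
      (TopologicalSpace.PositiveCompacts.isCompact _).measurableSet] at h
    simpa [measure_univ] using h

instance : μ.IsInvInvariant where
  inv_eq_self := by
    have h := Measure.haarMeasure_unique μ.inv (⊤ : TopologicalSpace.PositiveCompacts SO3)
    change _ = _ • μ at h
    rw [Measure.inv_apply] at h
    simpa [measure_univ] using h

theorem exists_norm_le {f : SO3 → ℂ} (hf : Continuous f) : ∃ C, ∀ x, ‖f x‖ ≤ C := by
  obtain ⟨C, hC⟩ := isCompact_univ.exists_bound_of_continuousOn hf.continuousOn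
  exact ⟨C, fun x => hC x trivial⟩

theorem integrable_of_continuous {f : SO3 → ℂ} (hf : Continuous f) : Integrable f μ := by
  obtain ⟨C, hC⟩ := exists_norm_le hf
  exact Integrable.of_bound hf.aestronglyMeasurable C (ae_of_all _ hC)

theorem integrable_mul {f g : SO3 → ℂ} (hf : Continuous f) (hg : Continuous g) :
    Integrable (fun x => f x * g x) μ := integrable_of_continuous (hf.mul hg)

theorem HasX.integral_eq_zero {i : Fin 3} {f f' : SO3 → ℂ} (h : HasX i f f')
    (hf : Continuous f) (hf' : Continuous f') : ∫ x, f' x ∂μ = 0 := by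
  obtain ⟨C, hC⟩ := exists_norm_le hf'
  have hm : ∀ {g : SO3 → ℂ}, Continuous g → ∀ t : ℝ, Continuous fun x => g (x * rot i t) :=
    fun hg t => hg.comp (continuous_mul_const _)
  have key := (hasDerivAt_integral_of_dominated_loc_of_deriv_le (μ := μ) (s := Set.univ)
    (F := fun (t : ℝ) x => f (x * rot i t)) (F' := fun (t : ℝ) x => f' (x * rot i t))
    (bound := fun _ => C) (x₀ := (0 : ℝ)) Filter.univ_mem
    (Filter.Eventually.of_forall fun t => (hm hf t).aestronglyMeasurable)
    (integrable_of_continuous (hm hf 0)) (hm hf' 0).aestronglyMeasurable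
    (ae_of_all _ fun x t _ => hC _) (integrable_const C)
    (ae_of_all _ fun x t _ => h.hasDerivAt x t)).2
  simp only [integral_mul_right_eq_self f] at key
  simp only [integral_mul_right_eq_self f'] at key
  exact key.unique (hasDerivAt_const _ _)

/-- Integration by parts: the left-invariant fields are skew-adjoint. -/
theorem HasX.integral_mul {i : Fin 3} {f f' g g' : SO3 → ℂ} (hf : HasX i f f') (hg : HasX i g g')
    (cf : Continuous f) (cf' : Continuous f') (cg : Continuous g) (cg' : Continuous g') :
    ∫ x, f x * g' x ∂μ = -∫ x, f' x * g x ∂μ := by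
  have h := (hf.mul hg).integral_eq_zero (cf.mul cg) ((cf'.mul cg).add (cf.mul cg'))
  rw [integral_add (integrable_mul cf' cg) (integrable_mul cf cg')] at h
  exact (neg_eq_of_add_eq_zero_right h).symm

theorem integral_mul_laplacian {f ψ : SO3 → ℂ} {f₁ f₂ : Fin 3 → SO3 → ℂ} (hψ : IsSmooth ψ)
    (h₁ : ∀ i, HasX i f (f₁ i)) (h₂ : ∀ i, HasX i (f₁ i) (f₂ i)) (cf : Continuous f)
    (cf₁ : ∀ i, Continuous (f₁ i)) (cf₂ : ∀ i, Continuous (f₂ i)) :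
    ∫ x, f x * laplacian ψ x ∂μ = ∫ x, (-∑ i, f₂ i x) * ψ x ∂μ := by
  have cX : ∀ {h : SO3 → ℂ}, IsSmooth h → Continuous h := fun h => IsCk.continuous h
  have key : ∀ i, ∫ x, f x * X i (X i ψ) x ∂μ = ∫ x, f₂ i x * ψ x ∂μ := fun i => by
    rw [(h₁ i).integral_mul ((hψ.X i).hasX i) cf (cf₁ i) (cX (hψ.X i)) (cX ((hψ.X i).X i)),
      (h₂ i).integral_mul (hψ.hasX i) (cf₁ i) (cf₂ i) (cX hψ) (cX (hψ.X i)), neg_neg]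
  simp only [laplacian, mul_neg, neg_mul, Finset.mul_sum, Finset.sum_mul, integral_neg]
  rw [integral_finsetSum _ fun i _ => integrable_mul cf (cX ((hψ.X i).X i)),
    integral_finsetSum _ fun i _ => integrable_mul (cf₂ i) (cX hψ)]
  simp only [key]

theorem IsCk.XWord {k : ℕ} {w : List (Fin 3)} {f : SO3 → ℂ}
    (hf : IsCk ((w.length + k : ℕ) : ℕ∞) f) : IsCk k (XWord w f) := by
  induction w generalizing k with
  | nil => simpa [SurfaceSpline.XWord] using hf
  | cons i w ih =>
    refine IsCk.X (k := (k : ℕ∞)) ?_ i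
    have : IsCk ((k + 1 : ℕ) : ℕ∞) (SurfaceSpline.XWord w f) := ih (by
      convert hf using 2
      simp only [List.length_cons]
      ring)
    exact_mod_cast this

/-- Classical derivatives are weak derivatives. -/
theorem IsCk.isWeakDeriv {w : List (Fin 3)} {f : SO3 → ℂ} (hf : IsCk (w.length : ℕ∞) f) :
    IsWeakDeriv w f (SurfaceSpline.XWord w f) := by
  induction w with
  | nil =>
    intro φ _
    simp [SurfaceSpline.XWord]
  | cons i w ih =>
    intro φ hφ
    have h0 : IsCk ((w.length + 1 : ℕ) : ℕ∞) f := hf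
    have h1 : IsCk ((1 : ℕ) : ℕ∞) (SurfaceSpline.XWord w f) := h0.XWord
    have h2 := ih (h0.of_le (by exact_mod_cast Nat.le_succ _)) (SurfaceSpline.X i φ) (hφ.X i)
    have h3 : SurfaceSpline.XWord (i :: w).reverse φ =
        SurfaceSpline.XWord w.reverse (SurfaceSpline.X i φ) := by
      simp [SurfaceSpline.XWord, List.foldr_append]
    have h4 : IsCk (0 + 1) (SurfaceSpline.XWord w f) := by simpa using h1
    rw [h3, h2, (h4.hasX i).integral_mul (hφ.hasX i) h4.continuous (h4.X i).continuous
      (IsCk.continuous hφ) (IsCk.continuous (hφ.X i)), List.length_cons, pow_succ]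
    simp [SurfaceSpline.XWord]

/-! ### Polynomials in the matrix entries -/

/-- The matrix entry `x ↦ x_{ab}` as a complex function on `SO(3)`. -/
def entry (a b : Fin 3) : SO3 → ℂ := fun x => (x.1 a b : ℂ)

theorem isSmooth_entry (a b : Fin 3) : IsSmooth (entry a b) :=
  ⟨fun A => (A a b : ℂ),
    Complex.ofRealCLM.contDiff.comp (contDiff_apply_apply ℝ ℝ a b), fun _ => rfl⟩

theorem hasX_entry (i a b : Fin 3) :
    HasX i (entry a b) (fun x => ∑ c, entry a c x * (rotGen i c b : ℂ)) := by
  intro x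
  have h : HasDerivAt (fun t : ℝ => (x * rot i t).1 a b) (∑ c, x.1 a c * rotGen i c b) 0 := by
    rw [show (fun t : ℝ => (x * rot i t).1 a b) = fun t => ∑ c, x.1 a c * rotMatrix i t c b from
      funext fun t => Matrix.mul_apply]
    exact HasDerivAt.fun_sum fun c _ => (hasDerivAt_rotMatrix i c b).const_mul _
  simpa [entry] using h.ofReal_comp

theorem X_entry (i a b : Fin 3) :
    X i (entry a b) = fun x => ∑ c, entry a c x * (rotGen i c b : ℂ) := (hasX_entry i a b).X_eq

theorem sum_entry_mul_entry (a c : Fin 3) (x : SO3) :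
    entry a 0 x * entry c 0 x + entry a 1 x * entry c 1 x + entry a 2 x * entry c 2 x =
      if a = c then 1 else 0 := by
  have h := congrFun (congrFun (SO3.mul_transpose x) a) c
  simp only [Matrix.mul_apply, Matrix.transpose_apply, Matrix.one_apply, Fin.sum_univ_three] at h
  have h2 := congrArg (fun r : ℝ => (r : ℂ)) h
  split_ifs at h2 ⊢ with hac <;> simpa [entry, hac] using h2

/-- The carré du champ of two matrix entries. -/
theorem sum_X_entry_mul_X_entry (a b c d : Fin 3) (x : SO3) :
    ∑ i, X i (entry a b) x * X i (entry c d) x =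
      (if a = c then 1 else 0) * (if b = d then 1 else 0) - entry a d x * entry c b x := by
  have h := sum_entry_mul_entry a c x
  simp only [X_entry, Fin.sum_univ_three]
  rw [← h]
  clear h
  fin_cases b <;> fin_cases d <;> simp [rotGen] <;> ring

theorem laplacian_entry (a b : Fin 3) : laplacian (entry a b) = fun x => 2 * entry a b x := by
  have key : ∀ i, HasX i (X i (entry a b))
      (fun x => ∑ c, (rotGen i c b : ℂ) * ∑ d, entry a d x * (rotGen i d c : ℂ)) := fun i => by
    rw [X_entry]
    simp only [mul_comm (entry a _ _)]
    refine HasX.sum fun c _ => HasX.const_mul _ ?_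
    simpa only [mul_comm (entry a _ _)] using hasX_entry i a c
  funext x
  simp only [laplacian, (key _).X_eq, Fin.sum_univ_three]
  fin_cases b <;> simp [rotGen] <;> ring

/-- For a rotation, each `2 × 2` minor with cyclically ordered rows and columns is the
complementary entry, because the adjugate is the transpose. -/
theorem entry_cofactor (a b : Fin 3) (x : SO3) :
    entry (a + 1) (b + 1) x * entry (a + 2) (b + 2) x -
      entry (a + 1) (b + 2) x * entry (a + 2) (b + 1) x = entry a b x := by
  have hdet : x.1.det = 1 := (Matrix.mem_specialOrthogonalGroup_iff.1 x.2).2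
  have h1 : x.1.adjugate = x.1.transpose := by
    calc x.1.adjugate = x.1.adjugate * (x.1 * x.1.transpose) := by
          rw [SO3.mul_transpose, mul_one]
      _ = x.1.transpose := by rw [← mul_assoc, Matrix.adjugate_mul, hdet, one_smul, one_mul]
  have h2 := congrFun (congrFun h1 b) a
  rw [Matrix.adjugate_fin_three] at h2
  have h3 := congrArg (fun r : ℝ => (r : ℂ)) h2
  fin_cases a <;> fin_cases b <;> simp [entry] at h3 ⊢ <;> linear_combination h3

theorem fin_three_cases (a c : Fin 3) :
    a = c ∨ (∃ e, a = e + 1 ∧ c = e + 2) ∨ ∃ e, a = e + 2 ∧ c = e + 1 := by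
  revert a c
  decide

/-- Exchanging the column indices of two entries changes their product by a multiple of a single
entry: a product of entries is symmetric in its column indices up to lower degree. -/
theorem exists_entry_swap (a b c d : Fin 3) : ∃ (e f : Fin 3) (s : ℂ), ∀ x,
    entry a b x * entry c d x - entry a d x * entry c b x = s * entry e f x := by
  rcases fin_three_cases a c with rfl | ⟨e, rfl, rfl⟩ | ⟨e, rfl, rfl⟩
  · exact ⟨0, 0, 0, fun x => by ring⟩
  all_goals rcases fin_three_cases b d with rfl | ⟨f, rfl, rfl⟩ | ⟨f, rfl, rfl⟩
  · exact ⟨0, 0, 0, fun x => by ring⟩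
  · exact ⟨e, f, 1, fun x => by linear_combination entry_cofactor e f x⟩
  · exact ⟨e, f, -1, fun x => by linear_combination -entry_cofactor e f x⟩
  · exact ⟨0, 0, 0, fun x => by ring⟩
  · exact ⟨e, f, -1, fun x => by linear_combination -entry_cofactor e f x⟩
  · exact ⟨e, f, 1, fun x => by linear_combination entry_cofactor e f x⟩

/-- The polynomials of degree at most `n` in the matrix entries. -/
def entryPoly : ℕ → Submodule ℂ (SO3 → ℂ)
  | 0 => Submodule.span ℂ {fun _ => 1}
  | n + 1 => Submodule.span ℂ ((entryPoly n : Set (SO3 → ℂ)) ∪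
      {f | ∃ a b, ∃ g ∈ entryPoly n, f = fun x => entry a b x * g x})

/-- The polynomials of degree less than `n` in the matrix entries. -/
def entryPolyLT : ℕ → Submodule ℂ (SO3 → ℂ)
  | 0 => ⊥
  | n + 1 => entryPoly n

theorem entryPoly_le_succ (n : ℕ) : entryPoly n ≤ entryPoly (n + 1) := fun _ hf =>
  Submodule.subset_span (Or.inl hf)

theorem entryPoly_mono : Monotone entryPoly := monotone_nat_of_le_succ entryPoly_le_succ

theorem entryPolyLT_le (n : ℕ) : entryPolyLT n ≤ entryPoly n := by
  cases n with
  | zero => exact bot_le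
  | succ n => exact entryPoly_le_succ n

theorem entry_mul_mem {n : ℕ} {f : SO3 → ℂ} (hf : f ∈ entryPoly n) (a b : Fin 3) :
    (fun x => entry a b x * f x) ∈ entryPoly (n + 1) :=
  Submodule.subset_span (Or.inr ⟨a, b, f, hf, rfl⟩)

theorem entry_mul_mem_of_lt {n : ℕ} {f : SO3 → ℂ} (hf : f ∈ entryPolyLT n) (a b : Fin 3) :
    (fun x => entry a b x * f x) ∈ entryPoly n := by
  cases n with
  | zero =>
    rw [(Submodule.mem_bot ℂ).1 hf]
    convert (entryPoly 0).zero_mem using 1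
    ext x
    simp
  | succ n => exact entry_mul_mem hf a b

theorem const_mem_entryPoly (n : ℕ) (c : ℂ) : (fun _ => c) ∈ entryPoly n := by
  refine entryPoly_mono (Nat.zero_le n) ?_
  have h := (entryPoly 0).smul_mem c (Submodule.subset_span rfl)
  convert h using 1
  ext x
  simp

/-- Induction over the generators of `entryPoly n`. -/
theorem entryPoly_induction {motive : ℕ → (SO3 → ℂ) → Prop} (one : motive 0 fun _ => 1)
    (zero : ∀ n, motive n 0)
    (add : ∀ n f g, f ∈ entryPoly n → g ∈ entryPoly n → motive n f → motive n g →
      motive n (fun x => f x + g x))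
    (smul : ∀ n (c : ℂ) f, f ∈ entryPoly n → motive n f → motive n (fun x => c * f x))
    (succ : ∀ n f, f ∈ entryPoly n → motive n f → motive (n + 1) f)
    (entry_mul : ∀ n f a b, f ∈ entryPoly n → motive n f →
      motive (n + 1) fun x => entry a b x * f x)
    {n : ℕ} {f : SO3 → ℂ} (hf : f ∈ entryPoly n) : motive n f := by
  induction n generalizing f with
  | zero =>
    refine Submodule.span_induction ?_ (zero 0) (fun f g hf hg => add 0 f g hf hg)
      (fun c f hf => smul 0 c f hf) hf
    rintro _ rfl
    exact one
  | succ n ih =>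
    refine Submodule.span_induction ?_ (zero _) (fun f g hf hg => add _ f g hf hg)
      (fun c f hf => smul _ c f hf) hf
    rintro f (hf | ⟨a, b, g, hg, rfl⟩)
    · exact succ n f hf (ih hf)
    · exact entry_mul n g a b hg (ih hg)

theorem isSmooth_const (c : ℂ) : IsSmooth fun _ => c := IsCk.const c

theorem isSmooth_of_mem_entryPoly {n : ℕ} {f : SO3 → ℂ} (hf : f ∈ entryPoly n) : IsSmooth f :=
  entryPoly_induction (motive := fun _ f => IsSmooth f) (isSmooth_const 1)
    (fun _ => isSmooth_const 0) (fun _ _ _ _ _ => IsCk.add) (fun _ c _ _ => IsCk.const_mul c)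
    (fun _ _ _ h => h) (fun _ _ a b _ h => IsCk.mul (isSmooth_entry a b) h) hf

theorem X_const (i : Fin 3) (c : ℂ) : X i (fun _ => c) = fun _ => 0 := by
  funext x
  simp [X]

theorem X_zero (i : Fin 3) : X i 0 = 0 := X_const i 0

theorem laplacian_const (c : ℂ) : laplacian (fun _ => c) = fun _ => 0 := by
  funext x
  simp [laplacian, X_const]

/-- The carré du champ with a matrix entry acts on polynomials of degree `n` as multiplication by
`-n` times that entry, up to lower degree. -/
theorem carre_du_champ_entry_mem {n : ℕ} {f : SO3 → ℂ} (hf : f ∈ entryPoly n) (a b : Fin 3) :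
    (fun x => ∑ i, X i (entry a b) x * X i f x + n * (entry a b x * f x)) ∈ entryPoly n := by
  refine entryPoly_induction (motive := fun n f =>
    (fun x => ∑ i, X i (entry a b) x * X i f x + n * (entry a b x * f x)) ∈ entryPoly n)
    ?_ ?_ ?_ ?_ ?_ ?_ hf
  · simpa [X_const] using const_mem_entryPoly 0 0
  · intro n
    simpa [X_zero] using const_mem_entryPoly n 0
  · intro n f g hf hg h1 h2
    convert (entryPoly n).add_mem h1 h2 using 1
    funext x
    simp only [X_add (isSmooth_of_mem_entryPoly hf) (isSmooth_of_mem_entryPoly hg), mul_add,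
      Finset.sum_add_distrib, Pi.add_apply]
    ring
  · intro n c f hf h1
    convert (entryPoly n).smul_mem c h1 using 1
    funext x
    simp only [X_const_mul c (isSmooth_of_mem_entryPoly hf), Pi.smul_apply, smul_eq_mul, mul_add,
      Finset.mul_sum]
    congr 1
    · exact Finset.sum_congr rfl fun i _ => by ring
    · ring
  · intro n f hf h1
    convert (entryPoly (n + 1)).add_mem (entryPoly_le_succ n h1) (entry_mul_mem hf a b) using 1
    funext x
    simp only [Pi.add_apply]
    push_cast
    ring
  · intro n g c d hg h1
    obtain ⟨e, f, s, hs⟩ := exists_entry_swap a b c d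
    convert (entryPoly (n + 1)).add_mem (entry_mul_mem h1 c d)
      ((entryPoly (n + 1)).add_mem
        ((entryPoly (n + 1)).smul_mem ((if a = c then 1 else 0) * (if b = d then 1 else 0))
          (entryPoly_le_succ n hg))
        ((entryPoly (n + 1)).smul_mem s (entry_mul_mem hg e f))) using 1
    funext x
    have h2 := hs x
    have h3 := sum_X_entry_mul_X_entry a b c d x
    simp only [X_mul (isSmooth_entry c d) (isSmooth_of_mem_entryPoly hg), Pi.add_apply,
      Pi.smul_apply, smul_eq_mul]
    have h4 : ∑ i, X i (entry a b) x * (X i (entry c d) x * g x + entry c d x * X i g x) =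
        (∑ i, X i (entry a b) x * X i (entry c d) x) * g x +
          entry c d x * ∑ i, X i (entry a b) x * X i g x := by
      rw [Finset.sum_mul, Finset.mul_sum, ← Finset.sum_add_distrib]
      exact Finset.sum_congr rfl fun i _ => by ring
    rw [h4, h3]
    push_cast
    linear_combination g x * h2

theorem laplacian_mul {f g : SO3 → ℂ} (hf : IsSmooth f) (hg : IsSmooth g) (x : SO3) :
    laplacian (fun x => f x * g x) x =
      laplacian f x * g x + f x * laplacian g x - 2 * ∑ i, X i f x * X i g x := by
  have h : ∀ i, X i (X i (fun x => f x * g x)) x =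
      X i (X i f) x * g x + f x * X i (X i g) x + 2 * (X i f x * X i g x) := fun i => by
    rw [X_mul hf hg, X_add (IsCk.mul (hf.X i) hg) (IsCk.mul hf (hg.X i)), X_mul (hf.X i) hg,
      X_mul hf (hg.X i)]
    ring
  simp only [laplacian, h, Finset.sum_add_distrib, ← Finset.mul_sum, ← Finset.sum_mul]
  ring

/-- The Laplacian acts on polynomials of degree `n` in the matrix entries as multiplication by
`n (n + 1)`, up to lower degree. -/
theorem laplacian_sub_mem {n : ℕ} {f : SO3 → ℂ} (hf : f ∈ entryPoly n) :
    (fun x => laplacian f x - (n : ℂ) * ((n : ℂ) + 1) * f x) ∈ entryPolyLT n := by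
  refine entryPoly_induction (motive := fun n f =>
    (fun x => laplacian f x - (n : ℂ) * ((n : ℂ) + 1) * f x) ∈ entryPolyLT n)
    ?_ ?_ ?_ ?_ ?_ ?_ hf
  · rw [laplacian_const]
    convert (entryPolyLT 0).zero_mem using 1
    funext x
    simp
  · intro n
    have h0 : laplacian 0 = 0 := laplacian_const 0
    convert (entryPolyLT n).zero_mem using 1
    funext x
    simp [h0]
  · intro n f g hf hg h1 h2
    convert (entryPolyLT n).add_mem h1 h2 using 1
    funext x
    rw [laplacian_add (isSmooth_of_mem_entryPoly hf) (isSmooth_of_mem_entryPoly hg)]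
    simp only [Pi.add_apply]
    ring
  · intro n c f hf h1
    convert (entryPolyLT n).smul_mem c h1 using 1
    funext x
    rw [laplacian_const_mul c (isSmooth_of_mem_entryPoly hf)]
    simp only [Pi.smul_apply, smul_eq_mul]
    ring
  · intro n f hf h1
    change _ ∈ entryPoly n
    convert (entryPoly n).add_mem (entryPolyLT_le n h1)
      ((entryPoly n).smul_mem ((n : ℂ) * (n + 1) - ((n + 1 : ℕ) : ℂ) * ((n + 1 : ℕ) + 1)) hf)
      using 1
    funext x
    simp only [Pi.add_apply, Pi.smul_apply, smul_eq_mul]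
    ring
  · intro n g a b hg h1
    change _ ∈ entryPoly n
    convert (entryPoly n).sub_mem (entry_mul_mem_of_lt h1 a b)
      ((entryPoly n).smul_mem 2 (carre_du_champ_entry_mem hg a b)) using 1
    funext x
    rw [laplacian_mul (isSmooth_entry a b) (isSmooth_of_mem_entryPoly hg), laplacian_entry]
    simp only [Pi.sub_apply, Pi.smul_apply, smul_eq_mul]
    push_cast
    ring

theorem isSmooth_of_mem_polynomials {L : ℕ} {f : SO3 → ℂ} (hf : f ∈ polynomials L) :
    IsSmooth f := by
  refine Submodule.span_induction (fun p hp => hp.1) (isSmooth_const 0)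
    (fun _ _ _ _ => IsCk.add) (fun c _ _ => IsCk.const_mul c) hf

theorem polynomials_mono {L M : ℕ} (h : L ≤ M) : polynomials L ≤ polynomials M :=
  Submodule.span_mono fun _ ⟨hp, l, hl, he⟩ => ⟨hp, l, hl.trans h, he⟩

/-- The Laplacian shifted by the next eigenvalue is onto on `Π_L`. -/
theorem exists_laplacian_sub_eq {L : ℕ} {h : SO3 → ℂ} (hh : h ∈ polynomials L) :
    ∃ u ∈ polynomials L, ∀ x,
      laplacian u x - ((L + 1 : ℕ) : ℂ) * (((L + 1 : ℕ) : ℂ) + 1) * u x = h x := by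
  refine Submodule.span_induction ?_ ?_ ?_ ?_ hh
  · rintro p ⟨hp, l, hl, he⟩
    have hne : (l : ℂ) * (l + 1) - ((L + 1 : ℕ) : ℂ) * (((L + 1 : ℕ) : ℂ) + 1) ≠ 0 := by
      rw [sub_ne_zero]
      norm_cast
      intro h0
      nlinarith
    set c := (l : ℂ) * (l + 1) - ((L + 1 : ℕ) : ℂ) * (((L + 1 : ℕ) : ℂ) + 1) with hc
    refine ⟨fun x => c⁻¹ * p x, (polynomials L).smul_mem c⁻¹
      (Submodule.subset_span ⟨hp, l, hl, he⟩), fun x => ?_⟩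
    rw [laplacian_const_mul _ hp]
    dsimp only
    rw [he]
    calc _ = c⁻¹ * c * p x := by rw [hc]; ring
      _ = p x := by rw [inv_mul_cancel₀ hne, one_mul]
  · refine ⟨0, Submodule.zero_mem _, fun x => ?_⟩
    have h0 : laplacian 0 = 0 := laplacian_const 0
    simp [h0]
  · rintro f g - - ⟨u, hu, h1⟩ ⟨v, hv, h2⟩
    refine ⟨fun x => u x + v x, Submodule.add_mem _ hu hv, fun x => ?_⟩
    rw [laplacian_add (isSmooth_of_mem_polynomials hu) (isSmooth_of_mem_polynomials hv),
      Pi.add_apply, ← h1, ← h2]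
    ring
  · rintro c f - ⟨u, hu, h1⟩
    refine ⟨fun x => c * u x, Submodule.smul_mem _ c hu, fun x => ?_⟩
    rw [laplacian_const_mul c (isSmooth_of_mem_polynomials hu), Pi.smul_apply, smul_eq_mul, ← h1]
    ring

/-- Polynomials of degree at most `n` in the matrix entries are sums of eigenfunctions of the
Laplacian with eigenvalues `ℓ (ℓ + 1)`, `ℓ ≤ n`. -/
theorem entryPoly_le_polynomials (n : ℕ) : entryPoly n ≤ polynomials n := by
  induction n with
  | zero =>
    intro f hf
    have h := (Submodule.mem_bot ℂ).1 (laplacian_sub_mem hf)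
    refine Submodule.subset_span ⟨isSmooth_of_mem_entryPoly hf, 0, le_rfl, fun x => ?_⟩
    simpa using congrFun h x
  | succ n ih =>
    intro f hf
    obtain ⟨u, hu, hux⟩ := exists_laplacian_sub_eq (ih (laplacian_sub_mem hf))
    have hus := isSmooth_of_mem_polynomials hu
    have hfs := isSmooth_of_mem_entryPoly hf
    have h1 : (fun x => f x + (-1) * u x) ∈ polynomials (n + 1) := by
      refine Submodule.subset_span ⟨IsCk.add hfs (IsCk.const_mul (-1) hus), n + 1, le_rfl,
        fun x => ?_⟩
      rw [laplacian_add hfs (IsCk.const_mul (-1) hus), laplacian_const_mul _ hus]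
      linear_combination -hux x
    convert Submodule.add_mem _ h1 (polynomials_mono n.le_succ hu) using 1
    funext x
    simp

/-! ### Radial functions and their distribution -/

/-- The squared chordal distance to the identity, `sin² (ω(x) / 2) = (3 - tr x) / 4`. -/
noncomputable def sinSq (x : SO3) : ℝ := (3 - x.1.trace) / 4

theorem continuous_sinSq : Continuous sinSq :=
  (continuous_const.sub continuous_subtype_val.matrix_trace).div_const _

theorem measurable_sinSq : Measurable sinSq := continuous_sinSq.measurable

theorem hasDerivAt_trace_mul (B : Matrix (Fin 3) (Fin 3) ℝ) (i : Fin 3) (x : SO3) :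
    HasDerivAt (fun t : ℝ => ((x * rot i t).1 * B).trace) ((x.1 * rotGen i * B).trace) 0 := by
  have h : ∀ t : ℝ, ((x * rot i t).1 * B).trace =
      ∑ a, ∑ b, (∑ c, x.1 a c * rotMatrix i t c b) * B b a := fun t => by
    change ((x.1 * rotMatrix i t) * B).trace = _
    simp [Matrix.trace, Matrix.mul_apply]
  simp only [h]
  have h' : (x.1 * rotGen i * B).trace = ∑ a, ∑ b, (∑ c, x.1 a c * rotGen i c b) * B b a := by
    simp [Matrix.trace, Matrix.mul_apply]
  rw [h']
  exact HasDerivAt.fun_sum fun a _ => HasDerivAt.fun_sum fun b _ =>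
    (HasDerivAt.fun_sum fun c _ => (hasDerivAt_rotMatrix i c b).const_mul _).mul_const _

/-- The first derivative of `sinSq` along `Xᵢ`. -/
noncomputable def sinSqD (i : Fin 3) (x : SO3) : ℝ := -(x.1 * rotGen i).trace / 4

/-- The second derivative of `sinSq` along `Xᵢ`. -/
noncomputable def sinSqDD (i : Fin 3) (x : SO3) : ℝ := -(x.1 * rotGen i * rotGen i).trace / 4

theorem continuous_sinSqD (i : Fin 3) : Continuous (sinSqD i) :=
  (continuous_subtype_val.matrix_mul continuous_const).matrix_trace.neg.div_const _

theorem continuous_sinSqDD (i : Fin 3) : Continuous (sinSqDD i) :=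
  ((continuous_subtype_val.matrix_mul continuous_const).matrix_mul
    continuous_const).matrix_trace.neg.div_const _

theorem hasDerivAt_sinSq (i : Fin 3) (x : SO3) :
    HasDerivAt (fun t : ℝ => sinSq (x * rot i t)) (sinSqD i x) 0 := by
  have h := ((hasDerivAt_trace_mul 1 i x).const_sub 3).div_const 4
  simpa [sinSq, sinSqD] using h

theorem hasDerivAt_sinSqD (i : Fin 3) (x : SO3) :
    HasDerivAt (fun t : ℝ => sinSqD i (x * rot i t)) (sinSqDD i x) 0 := by
  have h := (hasDerivAt_trace_mul (rotGen i) i x).neg.div_const 4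
  simpa [sinSqD, sinSqDD] using h

theorem sum_sinSqDD (x : SO3) : ∑ i, sinSqDD i x = 3 / 2 - 2 * sinSq x := by
  simp [sinSqDD, sinSq, Fin.sum_univ_three, Matrix.trace, Matrix.mul_apply, rotGen]
  ring

/-- The squared gradient of `sin² (ω / 2)` is `sin² (ω / 2) cos² (ω / 2)`. -/
theorem sum_sinSqD_sq (x : SO3) : ∑ i, sinSqD i x ^ 2 = sinSq x * (1 - sinSq x) := by
  have hcof : ∀ a b : Fin 3, x.1 (a + 1) (b + 1) * x.1 (a + 2) (b + 2) -
      x.1 (a + 1) (b + 2) * x.1 (a + 2) (b + 1) = x.1 a b := fun a b => by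
    have h := entry_cofactor a b x
    simp only [entry] at h
    exact_mod_cast h
  have hrow : ∀ a : Fin 3, x.1 a 0 * x.1 a 0 + x.1 a 1 * x.1 a 1 + x.1 a 2 * x.1 a 2 = 1 :=
    fun a => by
      have h := sum_entry_mul_entry a a x
      simp only [entry, if_true] at h
      exact_mod_cast h
  have c0 := hcof 0 0
  have c1 := hcof 1 1
  have c2 := hcof 2 2
  have r0 := hrow 0
  have r1 := hrow 1
  have r2 := hrow 2
  simp at c0 c1 c2
  simp [sinSqD, sinSq, Fin.sum_univ_three, Matrix.trace, rotGen, Matrix.mul_apply]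
  linear_combination (1 / 16) * (r0 + r1 + r2) + (1 / 8) * (c0 + c1 + c2)

theorem sinSq_nonneg (x : SO3) : 0 ≤ sinSq x := by
  have h : ∀ a : Fin 3, x.1 a a ≤ 1 := fun a => by
    have h := sum_entry_mul_entry a a x
    simp only [entry, if_true] at h
    have h1 : x.1 a 0 * x.1 a 0 + x.1 a 1 * x.1 a 1 + x.1 a 2 * x.1 a 2 = 1 := by exact_mod_cast h
    fin_cases a <;> simp at h1 ⊢ <;> nlinarith
  simp only [sinSq, Matrix.trace, Matrix.diag, Fin.sum_univ_three]
  linarith [h 0, h 1, h 2]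

theorem sinSq_le_one (x : SO3) : sinSq x ≤ 1 := by
  by_contra! h
  have h1 := sum_sinSqD_sq x
  have h2 : 0 ≤ ∑ i, sinSqD i x ^ 2 := Finset.sum_nonneg fun i _ => sq_nonneg _
  nlinarith

theorem sinSq_mem (x : SO3) : sinSq x ∈ Set.Icc (0 : ℝ) 1 := ⟨sinSq_nonneg x, sinSq_le_one x⟩

theorem sinSq_eq (x : SO3) : sinSq x = Real.sin (angle x / 2) ^ 2 := by
  have h0 := sinSq_nonneg x
  have h1 := sinSq_le_one x
  unfold sinSq at h0 h1
  rw [Real.sin_sq_eq_half_sub, mul_div_cancel₀ _ two_ne_zero, angle,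
    Real.cos_arccos (by linarith) (by linarith), sinSq]
  ring

theorem angle_nonneg (x : SO3) : 0 ≤ angle x := Real.arccos_nonneg _

theorem angle_le_pi (x : SO3) : angle x ≤ Real.pi := Real.arccos_le_pi _

theorem sin_half_angle (x : SO3) : Real.sin (angle x / 2) = √(sinSq x) := by
  rw [sinSq_eq, Real.sqrt_sq]
  exact Real.sin_nonneg_of_nonneg_of_le_pi (by linarith [angle_nonneg x])
    (by linarith [angle_le_pi x, Real.pi_pos])

theorem sqrt_sinSq_le (x : SO3) : √(sinSq x) ≤ angle x / 2 := by
  rw [← sin_half_angle]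
  exact Real.sin_le (by linarith [angle_nonneg x])

/-- The Laplacian of a radial function `G ∘ sinSq`, moved onto it from a smooth function by
integration by parts. -/
theorem integral_radial_mul_laplacian {G G₁ G₂ : ℝ → ℝ}
    (h₁ : ∀ u ∈ Set.Icc (0 : ℝ) 1, HasDerivAt G (G₁ u) u)
    (h₂ : ∀ u ∈ Set.Icc (0 : ℝ) 1, HasDerivAt G₁ (G₂ u) u)
    (h₃ : ContinuousOn G₂ (Set.Icc 0 1)) {ψ : SO3 → ℂ} (hψ : IsSmooth ψ) :
    ∫ x, (G (sinSq x) : ℂ) * laplacian ψ x ∂μ =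
      ∫ x, ((-(G₂ (sinSq x) * (sinSq x * (1 - sinSq x)) +
        G₁ (sinSq x) * (3 / 2 - 2 * sinSq x)) : ℝ) : ℂ) * ψ x ∂μ := by
  have cc : ∀ {H : ℝ → ℝ}, ContinuousOn H (Set.Icc 0 1) → Continuous fun x => H (sinSq x) :=
    fun hH => hH.comp_continuous continuous_sinSq sinSq_mem
  have c₁ : Continuous fun x => G₁ (sinSq x) :=
    cc fun u hu => (h₂ u hu).continuousAt.continuousWithinAt
  have key := integral_mul_laplacian (f := fun x => (G (sinSq x) : ℂ))
    (f₁ := fun i x => ((G₁ (sinSq x) * sinSqD i x : ℝ) : ℂ))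
    (f₂ := fun i x => ((G₂ (sinSq x) * sinSqD i x ^ 2 + G₁ (sinSq x) * sinSqDD i x : ℝ) : ℂ)) hψ
    (fun i x => by
      have h := HasDerivAt.comp_of_eq 0 (h₁ _ (sinSq_mem x)) (hasDerivAt_sinSq i x)
        (by simp [rot_zero])
      exact h.ofReal_comp)
    (fun i x => by
      have h := HasDerivAt.comp_of_eq 0 (h₂ _ (sinSq_mem x)) (hasDerivAt_sinSq i x)
        (by simp [rot_zero])
      have h' := (h.fun_mul (hasDerivAt_sinSqD i x)).ofReal_comp
      refine h'.congr_deriv ?_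
      simp only [Function.comp_apply, show x * rot i 0 = x by rw [rot_zero, mul_one]]
      congr 1
      ring)
    (Complex.continuous_ofReal.comp
      (cc fun u hu => (h₁ u hu).continuousAt.continuousWithinAt))
    (fun i => Complex.continuous_ofReal.comp (c₁.mul (continuous_sinSqD i)))
    (fun i => Complex.continuous_ofReal.comp
      (((cc h₃).mul ((continuous_sinSqD i).pow 2)).add (c₁.mul (continuous_sinSqDD i))))
  rw [key]
  refine integral_congr_ae (ae_of_all _ fun x => ?_)
  simp only
  rw [← Complex.ofReal_sum, ← Complex.ofReal_neg, Finset.sum_add_distrib, ← Finset.mul_sum,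
    ← Finset.mul_sum, sum_sinSqD_sq, sum_sinSqDD]

theorem integrable_radial {H : ℝ → ℝ} (hH : Continuous H) :
    Integrable (fun x => H (sinSq x)) μ := by
  have h := integrable_of_continuous (f := fun x => (H (sinSq x) : ℂ))
    (Complex.continuous_ofReal.comp (hH.comp continuous_sinSq))
  simpa using h.re

/-- The recursion for the moments of `sinSq`, from `∫ Δ (sinSq ^ (n + 1)) = 0`. -/
theorem integral_sinSq_pow_succ (n : ℕ) :
    ((n : ℝ) + 2) * ∫ x, sinSq x ^ (n + 1) ∂μ = (n + 3 / 2) * ∫ x, sinSq x ^ n ∂μ := by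
  have h := integral_radial_mul_laplacian (G := fun u => u ^ (n + 1))
    (G₁ := fun u => (n + 1) * u ^ n) (G₂ := fun u => (n + 1) * (n * u ^ (n - 1)))
    (fun u _ => by simpa using hasDerivAt_pow (n + 1) u)
    (fun u _ => (hasDerivAt_pow n u).const_mul _) (by fun_prop) (isSmooth_const 1)
  simp only [laplacian_const, mul_zero, integral_zero, mul_one] at h
  have h2 : (0 : ℂ) = ((∫ x, -((n + 1) * (n * sinSq x ^ (n - 1)) * (sinSq x * (1 - sinSq x)) +
      (n + 1) * sinSq x ^ n * (3 / 2 - 2 * sinSq x)) ∂μ : ℝ) : ℂ) := by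
    rw [h]
    exact integral_ofReal
  have h3 : ∀ x, -((n + 1) * (n * sinSq x ^ (n - 1)) * (sinSq x * (1 - sinSq x)) +
      (n + 1) * sinSq x ^ n * (3 / 2 - 2 * sinSq x)) =
      ((n : ℝ) + 1) * ((n + 2) * sinSq x ^ (n + 1) - (n + 3 / 2) * sinSq x ^ n) := fun x => by
    cases n with
    | zero => simp
    | succ n => push_cast; ring
  simp only [h3] at h2
  rw [integral_const_mul, integral_sub ((integrable_radial (continuous_pow (n + 1))).const_mul _)
    ((integrable_radial (continuous_pow n)).const_mul _), integral_const_mul,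
    integral_const_mul] at h2
  have h4 := (mul_eq_zero.1 (Complex.ofReal_eq_zero.1 h2.symm)).resolve_left (by positivity)
  linarith

/-- A probability measure on `[0, 1]` is determined by its moments. -/
theorem measure_ext_of_moments {m₁ m₂ : Measure ℝ} [IsProbabilityMeasure m₁]
    [IsProbabilityMeasure m₂] (h₁ : ∀ᵐ u ∂m₁, u ∈ Set.Icc (0 : ℝ) 1)
    (h₂ : ∀ᵐ u ∂m₂, u ∈ Set.Icc (0 : ℝ) 1) (h : ∀ n : ℕ, ∫ u, u ^ n ∂m₁ = ∫ u, u ^ n ∂m₂) :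
    m₁ = m₂ := by
  have hint : ∀ (m : Measure ℝ) [IsProbabilityMeasure m], (∀ᵐ u ∂m, u ∈ Set.Icc (0 : ℝ) 1) →
      ∀ n : ℕ, Integrable (fun u : ℝ => u ^ n) m := fun m _ hm n =>
    Integrable.of_bound (by fun_prop) 1 (hm.mono fun u hu => by
      rw [Real.norm_eq_abs, abs_pow, abs_of_nonneg hu.1]
      exact pow_le_one₀ hu.1 hu.2)
  have hpoly : ∀ p : Polynomial ℝ, ∫ u, p.eval u ∂m₁ = ∫ u, p.eval u ∂m₂ := fun p => by
    simp only [Polynomial.eval_eq_sum_range]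
    rw [integral_finsetSum _ fun n _ => (hint m₁ h₁ n).const_mul _,
      integral_finsetSum _ fun n _ => (hint m₂ h₂ n).const_mul _]
    simp only [integral_const_mul, h]
  have hpint : ∀ (m : Measure ℝ) [IsProbabilityMeasure m], (∀ᵐ u ∂m, u ∈ Set.Icc (0 : ℝ) 1) →
      ∀ p : Polynomial ℝ, Integrable (fun u => p.eval u) m := fun m _ hm p => by
    simp only [Polynomial.eval_eq_sum_range]
    exact integrable_finsetSum _ fun n _ => (hint m hm n).const_mul _
  refine ext_of_forall_integral_eq_of_IsFiniteMeasure fun f => ?_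
  have hb : ∀ ε > 0, |∫ u, f u ∂m₁ - ∫ u, f u ∂m₂| ≤ ε := by
    intro ε hε
    obtain ⟨p, hp⟩ := exists_polynomial_near_of_continuousOn 0 1 f f.continuous.continuousOn
      (ε / 2) (half_pos hε)
    have hd : ∀ (m : Measure ℝ) [IsProbabilityMeasure m], (∀ᵐ u ∂m, u ∈ Set.Icc (0 : ℝ) 1) →
        |∫ u, f u ∂m - ∫ u, p.eval u ∂m| ≤ ε / 2 := fun m _ hm => by
      rw [← integral_sub (f.integrable m) (hpint m hm p), ← Real.norm_eq_abs]
      have := norm_integral_le_of_norm_le_const (μ := m) (C := ε / 2)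
        (f := fun u => f u - p.eval u) (hm.mono fun u hu => by
          rw [Real.norm_eq_abs, abs_sub_comm]
          exact (hp u hu).le)
      simpa using this
    have d1 := abs_le.1 (hd m₁ h₁)
    have d2 := abs_le.1 (hd m₂ h₂)
    rw [hpoly p] at d1
    exact abs_le.2 ⟨by linarith [d1.1, d2.2], by linarith [d1.2, d2.1]⟩
  have h0 : |∫ u, f u ∂m₁ - ∫ u, f u ∂m₂| ≤ 0 := le_of_forall_pos_le_add fun ε hε => by
    simpa using hb ε hε
  exact sub_eq_zero.1 (abs_nonpos_iff.1 h0)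

/-- The law of the half rotation angle, reflected to `[0, π]`: density `(2 / π) sin² θ`. -/
noncomputable def halfAngleLaw : Measure ℝ :=
  (volume.restrict (Set.Ioc 0 Real.pi)).withDensity
    fun θ => ENNReal.ofReal (2 / Real.pi * Real.sin θ ^ 2)

theorem integral_halfAngleLaw (h : ℝ → ℝ) :
    ∫ θ, h θ ∂halfAngleLaw = ∫ θ in 0..Real.pi, 2 / Real.pi * Real.sin θ ^ 2 * h θ := by
  have hpi := Real.pi_pos
  rw [halfAngleLaw, integral_withDensity_eq_integral_toReal_smul (by fun_prop) (by simp),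
    intervalIntegral.integral_of_le hpi.le]
  refine integral_congr_ae (ae_of_all _ fun θ => ?_)
  simp only [smul_eq_mul]
  rw [ENNReal.toReal_ofReal (by positivity)]

instance : IsProbabilityMeasure halfAngleLaw := by
  have h := integral_halfAngleLaw fun _ => 1
  rw [integral_const, smul_eq_mul, mul_one] at h
  refine ⟨?_⟩
  have h2 : halfAngleLaw.real Set.univ = 1 := by
    rw [h]
    simp [integral_sin_sq]
  rwa [measureReal_def, ENNReal.toReal_eq_one_iff] at h2

/-- Weyl's integration formula for functions of the rotation angle. -/
theorem map_sinSq : μ.map sinSq = halfAngleLaw.map fun θ => Real.sin θ ^ 2 := by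
  have hm : Measurable fun θ : ℝ => Real.sin θ ^ 2 := by fun_prop
  have := Measure.isProbabilityMeasure_map (μ := μ) measurable_sinSq.aemeasurable
  have := Measure.isProbabilityMeasure_map (μ := halfAngleLaw) hm.aemeasurable
  have hI : MeasurableSet (Set.Icc (0 : ℝ) 1) := measurableSet_Icc
  refine measure_ext_of_moments ?_ ?_ fun n => ?_
  · exact (ae_map_iff measurable_sinSq.aemeasurable hI).2 (ae_of_all _ sinSq_mem)
  · exact (ae_map_iff hm.aemeasurable hI).2
      (ae_of_all _ fun θ => ⟨sq_nonneg _, Real.sin_sq_le_one θ⟩)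
  · rw [integral_map measurable_sinSq.aemeasurable (by fun_prop),
      integral_map hm.aemeasurable (by fun_prop)]
    induction n with
    | zero => simp
    | succ n ih =>
      have h1 := integral_sinSq_pow_succ n
      have h2 : ((n : ℝ) + 2) * ∫ θ, (Real.sin θ ^ 2) ^ (n + 1) ∂halfAngleLaw =
          (n + 3 / 2) * ∫ θ, (Real.sin θ ^ 2) ^ n ∂halfAngleLaw := by
        have e : ∀ (k : ℕ) (θ : ℝ), 2 / Real.pi * Real.sin θ ^ 2 * (Real.sin θ ^ 2) ^ k =
            2 / Real.pi * Real.sin θ ^ (2 * k + 2) := fun k θ => by ring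
        rw [integral_halfAngleLaw, integral_halfAngleLaw]
        simp only [e, intervalIntegral.integral_const_mul]
        rw [show 2 * (n + 1) + 2 = (2 * n + 2) + 2 by ring, integral_sin_pow (n := 2 * n + 2)]
        simp
        field_simp
        ring
      rw [ih, ← h2] at h1
      exact mul_left_cancel₀ (by positivity) h1

theorem integral_sinSq {h : ℝ → ℝ} (hh : Measurable h) :
    ∫ x, h (sinSq x) ∂μ =
      ∫ θ in 0..Real.pi, 2 / Real.pi * Real.sin θ ^ 2 * h (Real.sin θ ^ 2) := by
  rw [← integral_halfAngleLaw fun θ => h (Real.sin θ ^ 2),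
    ← integral_map measurable_sinSq.aemeasurable hh.aestronglyMeasurable, map_sinSq,
    integral_map (by fun_prop) hh.aestronglyMeasurable]

theorem lintegral_sinSq {h : ℝ → ℝ≥0∞} (hh : Measurable h) :
    ∫⁻ x, h (sinSq x) ∂μ = ∫⁻ θ in Set.Ioc 0 Real.pi,
      ENNReal.ofReal (2 / Real.pi * Real.sin θ ^ 2) * h (Real.sin θ ^ 2) := by
  have hm : Measurable fun θ : ℝ => Real.sin θ ^ 2 := by fun_prop
  rw [← lintegral_map hh measurable_sinSq, map_sinSq, lintegral_map hh hm, halfAngleLaw,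
    lintegral_withDensity_eq_lintegral_mul _ (by fun_prop)
      (show Measurable fun θ : ℝ => h (Real.sin θ ^ 2) from hh.comp hm)]
  rfl

theorem sinSq_pos_ae : ∀ᵐ x ∂μ, 0 < sinSq x := by
  have h : μ {x | sinSq x = 0} = 0 := by
    have h0 := lintegral_sinSq (h := Set.indicator {0} 1)
      (measurable_one.indicator (measurableSet_singleton 0))
    have h1 : ∀ θ : ℝ, ENNReal.ofReal (2 / Real.pi * Real.sin θ ^ 2) *
        Set.indicator {0} 1 (Real.sin θ ^ 2) = (0 : ℝ≥0∞) := fun θ => by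
      by_cases hθ : Real.sin θ ^ 2 = 0
      · simp [hθ]
      · rw [Set.indicator_of_notMem (by simpa using hθ), mul_zero]
    simp only [h1, lintegral_zero] at h0
    rw [← h0]
    exact (lintegral_indicator_one (measurable_sinSq (measurableSet_singleton 0))).symm
  have h' : ∀ᵐ x ∂μ, ¬ sinSq x = 0 := by simpa [ae_iff] using h
  exact h'.mono fun x hx => lt_of_le_of_ne (sinSq_nonneg x) (Ne.symm hx)

theorem integrable_inv_sinSq : Integrable (fun x => (sinSq x)⁻¹) μ := by
  refine ⟨measurable_sinSq.inv.aestronglyMeasurable, ?_⟩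
  have hpi := Real.pi_pos
  have e : ∀ x, ‖(sinSq x)⁻¹‖ₑ = ENNReal.ofReal (sinSq x)⁻¹ := fun x =>
    Real.enorm_of_nonneg (inv_nonneg.2 (sinSq_nonneg x))
  rw [HasFiniteIntegral, lintegral_congr e, lintegral_sinSq (h := fun u => ENNReal.ofReal u⁻¹)
    (by fun_prop)]
  refine lt_of_le_of_lt (lintegral_mono (g := fun _ => ENNReal.ofReal (2 / Real.pi))
    fun θ => ?_) ?_
  · rw [← ENNReal.ofReal_mul (by positivity)]
    refine ENNReal.ofReal_le_ofReal ?_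
    rw [mul_assoc]
    exact mul_le_of_le_one_right (by positivity) mul_inv_le_one
  · rw [lintegral_const]
    exact ENNReal.mul_lt_top ENNReal.ofReal_lt_top (by simp)

theorem integral_sinSq_rpow_neg_half : ∫ x, sinSq x ^ (-1 / 2 : ℝ) ∂μ = 4 / Real.pi := by
  rw [integral_sinSq (h := fun u => u ^ (-1 / 2 : ℝ)) (by fun_prop)]
  have h : ∀ θ ∈ Set.uIcc 0 Real.pi,
      2 / Real.pi * Real.sin θ ^ 2 * (Real.sin θ ^ 2) ^ (-1 / 2 : ℝ) =
        2 / Real.pi * Real.sin θ := fun θ hθ => by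
    rw [Set.uIcc_of_le Real.pi_pos.le] at hθ
    rcases (Real.sin_nonneg_of_mem_Icc hθ).eq_or_lt with h0 | h0
    · simp [← h0]
    · rw [mul_assoc]
      congr 1
      rw [← Real.rpow_two, ← Real.rpow_mul h0.le, ← Real.rpow_add h0]
      norm_num
  rw [intervalIntegral.integral_congr h, intervalIntegral.integral_const_mul, integral_sin]
  simp
  ring

/-- The decay of this kernel is what makes the error kernel of the approximation scheme of order
`r ^ (2m)` in `L₁`. -/
theorem lintegral_inv_sinSq_add_sq_le {r : ℝ} (hr : 0 < r) :
    ∫⁻ x, ENNReal.ofReal ((sinSq x + r ^ 2) ^ 2)⁻¹ ∂μ ≤ ENNReal.ofReal (2 * Real.pi / r) := by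
  have hpi := Real.pi_pos
  set c : ℝ := 2 / (Real.pi * r) with hc
  have hc0 : 0 < c := by positivity
  let w : ℝ → ℝ := fun θ => (r ^ 2)⁻¹ * (1 + (c * θ) ^ 2)⁻¹
  have hw0 : ∀ θ, 0 ≤ w θ := fun θ => by positivity
  have hwi : Integrable w := (integrable_inv_one_add_sq.comp_mul_left' hc0.ne').const_mul _
  have hwi' : Integrable fun θ => w (Real.pi - θ) := hwi.comp_sub_left Real.pi
  have hwI : ∫ θ, w θ = Real.pi ^ 2 / (2 * r) := by
    simp only [w]
    rw [integral_const_mul, Measure.integral_comp_mul_left (fun y : ℝ => (1 + y ^ 2)⁻¹) c,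
      integral_univ_inv_one_add_sq, abs_of_pos (inv_pos.2 hc0), hc, smul_eq_mul]
    field_simp
  -- Jordan's inequality bounds the integrand near each end of the interval.
  have hw : ∀ θ, 0 ≤ θ → θ ≤ Real.pi / 2 → (Real.sin θ ^ 2 + r ^ 2)⁻¹ ≤ w θ := fun θ h0 h1 => by
    have hs := Real.mul_le_sin h0 h1
    have hs2 : (2 / Real.pi * θ) ^ 2 ≤ Real.sin θ ^ 2 := pow_le_pow_left₀ (by positivity) hs 2
    simp only [w]
    rw [← mul_inv]
    refine inv_anti₀ (by positivity) ?_
    have : r ^ 2 * (1 + (c * θ) ^ 2) = (2 / Real.pi * θ) ^ 2 + r ^ 2 := by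
      rw [hc]
      field_simp
      ring
    linarith
  rw [lintegral_sinSq (h := fun u => ENNReal.ofReal ((u + r ^ 2) ^ 2)⁻¹) (by fun_prop)]
  calc _ ≤ ∫⁻ θ in Set.Ioc 0 Real.pi,
        ENNReal.ofReal (2 / Real.pi * (w θ + w (Real.pi - θ))) := by
        refine setLIntegral_mono' measurableSet_Ioc fun θ hθ => ?_
        rw [← ENNReal.ofReal_mul (by positivity), mul_assoc]
        refine ENNReal.ofReal_le_ofReal (mul_le_mul_of_nonneg_left ?_ (by positivity))
        have hpos : 0 < Real.sin θ ^ 2 + r ^ 2 := by positivity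
        have h1 : Real.sin θ ^ 2 * ((Real.sin θ ^ 2 + r ^ 2) ^ 2)⁻¹ ≤
            (Real.sin θ ^ 2 + r ^ 2)⁻¹ := by
          rw [← div_eq_mul_inv, div_le_iff₀ (by positivity), sq (Real.sin θ ^ 2 + r ^ 2),
            inv_mul_cancel_left₀ hpos.ne']
          nlinarith
        refine h1.trans ?_
        rcases le_total θ (Real.pi / 2) with h2 | h2
        · linarith [hw θ hθ.1.le h2, hw0 (Real.pi - θ)]
        · have := hw (Real.pi - θ) (by linarith [hθ.2]) (by linarith)
          rw [Real.sin_pi_sub] at this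
          linarith [hw0 θ]
    _ ≤ ∫⁻ θ, ENNReal.ofReal (2 / Real.pi * (w θ + w (Real.pi - θ))) :=
        setLIntegral_le_lintegral _ _
    _ = ENNReal.ofReal (2 * Real.pi / r) := by
        rw [← ofReal_integral_eq_lintegral_ofReal (f := fun θ => 2 / Real.pi * (w θ + w (Real.pi - θ)))
            ((hwi.add hwi').const_mul _)
          (ae_of_all _ fun θ => mul_nonneg (by positivity) (add_nonneg (hw0 _) (hw0 _))),
          integral_const_mul, integral_add hwi hwi', integral_sub_left_eq_self w, hwI]
        congr 1
        field_simp
        ring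

/-! ### The Green function of the spline operator -/

/-- `sinSq (α⁻¹ x)` is a multiple of the squared Frobenius distance of `x` and `α`. -/
theorem sinSq_inv_mul (α x : SO3) :
    sinSq (α⁻¹ * x) = (∑ a, ∑ b, (x.1 a b - α.1 a b) ^ 2) / 8 := by
  have h1 : (α⁻¹ * x).1.trace = ∑ a, ∑ b, α.1 a b * x.1 a b := by
    change (α.1.transpose * x.1).trace = _
    simp only [Matrix.trace, Matrix.diag, Matrix.mul_apply, Matrix.transpose_apply]
    exact Finset.sum_comm
  have h2 : ∀ y : SO3, ∑ a, ∑ b, y.1 a b ^ 2 = 3 := fun y => by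
    have h : ∀ a : Fin 3, ∑ b, y.1 a b ^ 2 = 1 := fun a => by
      have h := congrFun (congrFun (SO3.mul_transpose y) a) a
      simpa [Matrix.mul_apply, sq] using h
    simp [h]
  have h3 : ∑ a, ∑ b, (x.1 a b - α.1 a b) ^ 2 =
      ∑ a, ∑ b, x.1 a b ^ 2 + ∑ a, ∑ b, α.1 a b ^ 2 - 2 * ∑ a, ∑ b, α.1 a b * x.1 a b := by
    simp only [Finset.mul_sum, ← Finset.sum_add_distrib, ← Finset.sum_sub_distrib]
    exact Finset.sum_congr rfl fun a _ => Finset.sum_congr rfl fun b _ => by ring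
  rw [sinSq, h1, h3, h2, h2]
  ring

theorem abs_entry_sub_le (α x : SO3) (a b : Fin 3) :
    |x.1 a b - α.1 a b| ≤ √8 * √(sinSq (α⁻¹ * x)) := by
  rw [← Real.sqrt_mul (by norm_num), sinSq_inv_mul, mul_div_cancel₀ _ (by norm_num)]
  refine Real.abs_le_sqrt ?_
  refine le_trans ?_ (Finset.single_le_sum (f := fun a => ∑ b, (x.1 a b - α.1 a b) ^ 2)
    (fun a _ => Finset.sum_nonneg fun b _ => sq_nonneg _) (Finset.mem_univ a))
  exact Finset.single_le_sum (f := fun b => (x.1 a b - α.1 a b) ^ 2) (fun b _ => sq_nonneg _)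
    (Finset.mem_univ b)

theorem exists_norm_sub_one_le {ψ : SO3 → ℂ} (hψ : IsSmooth ψ) :
    ∃ C, ∀ x, ‖ψ x - ψ 1‖ ≤ C * √(sinSq x) := by
  obtain ⟨F, hF, hψ⟩ := hψ
  have hF1 : ContDiff ℝ 1 F := hF.of_le (by simp)
  have hc : IsCompact (Set.range fun x : SO3 => (x.1 : Fin 3 → Fin 3 → ℝ)) :=
    isCompact_range continuous_coe_matrix
  obtain ⟨K, hK⟩ := LocallyLipschitzOn.exists_lipschitzOnWith_of_compact
    (α := Fin 3 → Fin 3 → ℝ) hc hF1.locallyLipschitz.locallyLipschitzOn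
  refine ⟨K * √8, fun x => ?_⟩
  have h := hK.dist_le_mul _ ⟨x, rfl⟩ _ ⟨1, rfl⟩
  rw [hψ, hψ, ← dist_eq_norm, mul_assoc]
  refine h.trans (mul_le_mul_of_nonneg_left ?_ K.coe_nonneg)
  refine (dist_pi_le_iff (by positivity)).2 fun a => (dist_pi_le_iff (by positivity)).2 fun b => ?_
  have := abs_entry_sub_le 1 x a b
  rw [inv_one, one_mul] at this
  rwa [Real.dist_eq]

/-- Dominated convergence for radial kernels bounded by a multiple of the integrable function
`sinSq⁻¹`. -/
theorem tendsto_integral_radial {H : ℝ → ℝ → ℝ} {H₀ : ℝ → ℝ} {C M : ℝ} {φ : SO3 → ℂ}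
    (hm : ∀ ε, Measurable (H ε))
    (hH : ∀ ε, 0 < ε → ε ≤ 1 → ∀ s, 0 < s → s ≤ 1 → |H ε s| ≤ C * s⁻¹)
    (hlim : ∀ s, 0 < s → s ≤ 1 → Filter.Tendsto (fun ε => H ε s) (nhdsWithin 0 (Set.Ioi 0))
      (nhds (H₀ s)))
    (hφm : AEStronglyMeasurable φ μ) (hφ : ∀ x, ‖φ x‖ ≤ M) :
    Filter.Tendsto (fun ε => ∫ x, (H ε (sinSq x) : ℂ) * φ x ∂μ) (nhdsWithin 0 (Set.Ioi 0))
      (nhds (∫ x, (H₀ (sinSq x) : ℂ) * φ x ∂μ)) := by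
  refine tendsto_integral_filter_of_dominated_convergence (fun x => C * (sinSq x)⁻¹ * M) ?_ ?_ ?_ ?_
  · exact Filter.Eventually.of_forall fun ε =>
      (Complex.measurable_ofReal.comp ((hm ε).comp measurable_sinSq)).aestronglyMeasurable.mul hφm
  · filter_upwards [Ioc_mem_nhdsGT (show (0 : ℝ) < 1 by norm_num)] with ε hε
    filter_upwards [sinSq_pos_ae] with x hx
    have h1 := hH ε hε.1 hε.2 _ hx (sinSq_le_one x)
    rw [norm_mul, Complex.norm_real, Real.norm_eq_abs]
    exact mul_le_mul h1 (hφ x) (norm_nonneg _) ((abs_nonneg _).trans h1)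
  · exact (integrable_inv_sinSq.const_mul C).mul_const M
  · filter_upwards [sinSq_pos_ae] with x hx
    exact ((Complex.continuous_ofReal.tendsto _).comp (hlim _ hx (sinSq_le_one x))).mul_const _

theorem rpow_add_le {b s ε : ℝ} (hb : -1 / 2 ≤ b) (hs : 0 < s) (hs1 : s ≤ 1) (hε : 0 < ε)
    (hε1 : ε ≤ 1) : (s + ε) ^ b ≤ 2 ^ (b + 1 / 2) * s⁻¹ := by
  have h0 : 0 < s + ε := by positivity
  rw [show b = (b + 1 / 2) + (-1 / 2) by ring, Real.rpow_add h0]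
  have h1 : (s + ε) ^ (-1 / 2 : ℝ) ≤ s⁻¹ := by
    rw [← Real.rpow_neg_one]
    exact (Real.rpow_le_rpow_of_nonpos hs (by linarith) (by norm_num)).trans
      (Real.rpow_le_rpow_of_exponent_ge hs hs1 (by norm_num))
  refine mul_le_mul ?_ h1 (by positivity) (by positivity)
  rw [show b + 1 / 2 + (-1 / 2) + 1 / 2 = b + 1 / 2 by ring]
  exact Real.rpow_le_rpow h0.le (by linarith) (by linarith)

theorem tendsto_rpow_add (b : ℝ) {s : ℝ} (hs : 0 < s) :
    Filter.Tendsto (fun ε => (s + ε) ^ b) (nhdsWithin 0 (Set.Ioi 0)) (nhds (s ^ b)) := by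
  have h : ContinuousAt (fun ε : ℝ => (s + ε) ^ b) 0 :=
    ContinuousAt.rpow_const (by fun_prop) (Or.inl (by simpa using hs.ne'))
  have h2 := h.tendsto
  rw [add_zero] at h2
  exact h2.mono_left nhdsWithin_le_nhds

theorem integral_rpow_add_mul_laplacian (a : ℝ) {ε : ℝ} (hε : 0 < ε) {ψ : SO3 → ℂ}
    (hψ : IsSmooth ψ) :
    ∫ x, (((sinSq x + ε) ^ a : ℝ) : ℂ) * laplacian ψ x ∂μ =
      ∫ x, ((-(a * ((a - 1) * (sinSq x + ε) ^ (a - 2)) * (sinSq x * (1 - sinSq x)) +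
        a * (sinSq x + ε) ^ (a - 1) * (3 / 2 - 2 * sinSq x)) : ℝ) : ℂ) * ψ x ∂μ := by
  have hd : ∀ b : ℝ, ∀ u ∈ Set.Icc (0 : ℝ) 1,
      HasDerivAt (fun u => (u + ε) ^ b) (b * (u + ε) ^ (b - 1)) u := fun b u hu => by
    have h := ((hasDerivAt_id u).add_const ε).rpow_const (p := b)
      (Or.inl (show u + ε ≠ 0 by linarith [hu.1]))
    simpa using h
  refine integral_radial_mul_laplacian (G := fun u => (u + ε) ^ a)
    (G₁ := fun u => a * (u + ε) ^ (a - 1)) (G₂ := fun u => a * ((a - 1) * (u + ε) ^ (a - 2)))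
    (hd a) (fun u hu => ?_) ?_ hψ
  · have h := (hd (a - 1) u hu).const_mul a
    rwa [show a - 1 - 1 = a - 2 by ring] at h
  · refine continuousOn_const.mul (continuousOn_const.mul ?_)
    exact ContinuousOn.rpow_const (by fun_prop) fun u hu => Or.inl (by linarith [hu.1])

/-- The operator `Δ - a (a + 1)` lowers the exponent of `sinSq ^ a` by one. -/
theorem integral_sinSq_rpow_mul_laplacian_sub {a : ℝ} (ha : 1 / 2 ≤ a) {ψ : SO3 → ℂ}
    (hψ : IsSmooth ψ) :
    ∫ x, ((sinSq x ^ a : ℝ) : ℂ) * (laplacian ψ x - (a * (a + 1) : ℝ) * ψ x) ∂μ =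
      -(a * (a + 1 / 2) : ℝ) * ∫ x, ((sinSq x ^ (a - 1) : ℝ) : ℂ) * ψ x ∂μ := by
  have cψ : Continuous ψ := IsCk.continuous hψ
  have cΔ : Continuous (laplacian ψ) := IsCk.continuous hψ.laplacian
  obtain ⟨M, hM⟩ := exists_norm_le cψ
  obtain ⟨M', hM'⟩ := exists_norm_le cΔ
  have hL := tendsto_integral_radial (H := fun ε s => (s + ε) ^ a) (H₀ := fun s => s ^ a)
    (C := 2 ^ (a + 1 / 2)) (fun ε => by fun_prop)
    (fun ε hε hε1 s hs hs1 => by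
      rw [abs_of_nonneg (by positivity)]
      exact rpow_add_le (by linarith) hs hs1 hε hε1)
    (fun s hs _ => tendsto_rpow_add a hs) cΔ.aestronglyMeasurable hM'
  have hR := tendsto_integral_radial
    (H := fun ε s => -(a * ((a - 1) * (s + ε) ^ (a - 2)) * (s * (1 - s)) +
        a * (s + ε) ^ (a - 1) * (3 / 2 - 2 * s)))
    (H₀ := fun s => a * (a + 1) * s ^ a - a * (a + 1 / 2) * s ^ (a - 1))
    (C := (|a * (a - 1)| + |a| * 2) * 2 ^ (a - 1 + 1 / 2)) (fun ε => by fun_prop)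
    (fun ε hε hε1 s hs hs1 => by
      have h0 : 0 < s + ε := by positivity
      have h1 := rpow_add_le (b := a - 1) (by linarith) hs hs1 hε hε1
      have h2 : (s + ε) ^ (a - 2) * (s * (1 - s)) ≤ (s + ε) ^ (a - 1) := by
        rw [show a - 1 = (a - 2) + 1 by ring, Real.rpow_add_one h0.ne']
        exact mul_le_mul_of_nonneg_left (by nlinarith) (by positivity)
      have h3 : 0 ≤ (s + ε) ^ (a - 2) * (s * (1 - s)) :=
        mul_nonneg (by positivity) (mul_nonneg hs.le (by linarith))
      have h4 : |3 / 2 - 2 * s| ≤ 2 := abs_le.2 ⟨by linarith, by linarith⟩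
      have h5 : 0 ≤ (s + ε) ^ (a - 1) := by positivity
      rw [abs_neg]
      calc _ ≤ |a * (a - 1)| * ((s + ε) ^ (a - 2) * (s * (1 - s))) +
            |a| * ((s + ε) ^ (a - 1) * |3 / 2 - 2 * s|) := by
            refine (abs_add_le _ _).trans (le_of_eq ?_)
            rw [show a * ((a - 1) * (s + ε) ^ (a - 2)) * (s * (1 - s)) =
              a * (a - 1) * ((s + ε) ^ (a - 2) * (s * (1 - s))) by ring, abs_mul (a * (a - 1)),
              abs_of_nonneg h3, mul_assoc a ((s + ε) ^ (a - 1)), abs_mul a (_ * _),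
              abs_mul ((s + ε) ^ (a - 1)), abs_of_nonneg h5]
        _ ≤ |a * (a - 1)| * (s + ε) ^ (a - 1) + |a| * ((s + ε) ^ (a - 1) * 2) := by gcongr
        _ = (|a * (a - 1)| + |a| * 2) * (s + ε) ^ (a - 1) := by ring
        _ ≤ _ := by
            rw [mul_assoc]
            exact mul_le_mul_of_nonneg_left h1 (by positivity))
    (fun s hs _ => by
      have h2 := tendsto_rpow_add (a - 2) hs
      have h1 := tendsto_rpow_add (a - 1) hs
      have h := ((((h2.const_mul (a - 1)).const_mul a).mul_const (s * (1 - s))).add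
        ((h1.const_mul a).mul_const (3 / 2 - 2 * s))).neg
      convert h using 2
      have e1 : s ^ a = s ^ (a - 2) * s ^ 2 := by
        rw [← Real.rpow_two, ← Real.rpow_add hs]
        ring_nf
      have e2 : s ^ (a - 1) = s ^ (a - 2) * s := by
        rw [← Real.rpow_add_one hs.ne']
        ring_nf
      rw [e1, e2]
      ring) cψ.aestronglyMeasurable hM
  have key := tendsto_nhds_unique hL (hR.congr' (by
    filter_upwards [self_mem_nhdsWithin] with ε hε
    exact (integral_rpow_add_mul_laplacian a hε hψ).symm))
  have iA : ∀ {b : ℝ}, 0 ≤ b → ∀ {φ : SO3 → ℂ}, Continuous φ →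
      Integrable (fun x => ((sinSq x ^ b : ℝ) : ℂ) * φ x) μ := fun hb φ hφ =>
    integrable_mul (Complex.continuous_ofReal.comp
      (continuous_sinSq.rpow_const fun x => Or.inr hb)) hφ
  have iB : Integrable (fun x => ((sinSq x ^ (a - 1) : ℝ) : ℂ) * ψ x) μ := by
    refine (integrable_inv_sinSq.mul_const M).mono'
      ((Complex.measurable_ofReal.comp (measurable_sinSq.pow_const _)).aestronglyMeasurable.mul
        cψ.aestronglyMeasurable) (sinSq_pos_ae.mono fun x hx => ?_)
    rw [norm_mul, Complex.norm_real, Real.norm_of_nonneg (by positivity), ← Real.rpow_neg_one]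
    exact mul_le_mul (Real.rpow_le_rpow_of_exponent_ge hx (sinSq_le_one x) (by linarith)) (hM x)
      (norm_nonneg _) (by positivity)
  simp only [mul_sub]
  rw [integral_sub (iA (by linarith) cΔ)
    (iA (b := a) (by linarith) (φ := fun x => ((a * (a + 1) : ℝ) : ℂ) * ψ x)
      (continuous_const.mul cψ)), key]
  have e : ∀ x, ((a * (a + 1) * sinSq x ^ a - a * (a + 1 / 2) * sinSq x ^ (a - 1) : ℝ) : ℂ) * ψ x =
      ((sinSq x ^ a : ℝ) : ℂ) * (((a * (a + 1) : ℝ) : ℂ) * ψ x) -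
        ((a * (a + 1 / 2) : ℝ) : ℂ) * (((sinSq x ^ (a - 1) : ℝ) : ℂ) * ψ x) := fun x => by
    push_cast
    ring
  simp only [e]
  rw [integral_sub (iA (b := a) (by linarith) (φ := fun x => ((a * (a + 1) : ℝ) : ℂ) * ψ x)
      (continuous_const.mul cψ)) (iB.const_mul _), integral_const_mul]
  ring

/-- `(Δ + 1/4) (sinSq + ε)^{-1/2}` as a function of `s = sinSq`: an approximate identity. -/
noncomputable def poleKernel (ε s : ℝ) : ℝ :=
  (s + ε) ^ (-5 / 2 : ℝ) * (3 / 4 * ε - s * ε / 2 + ε ^ 2 / 4)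

theorem continuous_sinSq_add_rpow {ε : ℝ} (hε : 0 < ε) (b : ℝ) :
    Continuous fun x => (sinSq x + ε) ^ b :=
  Continuous.rpow_const (f := fun x => sinSq x + ε) (continuous_sinSq.add continuous_const)
    fun x => Or.inl (by linarith [sinSq_nonneg x])

theorem integral_rpow_add_mul_laplacian_add {ε : ℝ} (hε : 0 < ε) {ψ : SO3 → ℂ}
    (hψ : IsSmooth ψ) :
    ∫ x, (((sinSq x + ε) ^ (-1 / 2 : ℝ) : ℝ) : ℂ) * (laplacian ψ x + 1 / 4 * ψ x) ∂μ =
      ∫ x, (poleKernel ε (sinSq x) : ℂ) * ψ x ∂μ := by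
  have cψ : Continuous ψ := IsCk.continuous hψ
  have cr := continuous_sinSq_add_rpow hε
  have cc : ∀ b : ℝ, Continuous fun x => (((sinSq x + ε) ^ b : ℝ) : ℂ) := fun b =>
    Complex.continuous_ofReal.comp (cr b)
  have cs := continuous_sinSq
  simp only [mul_add]
  have cψ4 : Continuous fun x => 1 / 4 * ψ x := continuous_const.mul cψ
  have cG : Continuous fun x => ((-(-1 / 2 * ((-1 / 2 - 1) * (sinSq x + ε) ^ (-1 / 2 - 2 : ℝ)) *
      (sinSq x * (1 - sinSq x)) + -1 / 2 * (sinSq x + ε) ^ (-1 / 2 - 1 : ℝ) *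
        (3 / 2 - 2 * sinSq x)) : ℝ) : ℂ) := by
    have c1 := cr (-1 / 2 - 2)
    have c2 := cr (-1 / 2 - 1)
    fun_prop
  rw [integral_add (integrable_mul (cc _) (IsCk.continuous hψ.laplacian))
    (integrable_mul (cc _) cψ4), integral_rpow_add_mul_laplacian _ hε hψ,
    ← integral_add (integrable_mul cG cψ) (integrable_mul (cc _) cψ4)]
  · refine integral_congr_ae (ae_of_all _ fun x => ?_)
    have h0 : 0 < sinSq x + ε := by linarith [sinSq_nonneg x]
    have e2 : (sinSq x + ε) ^ (-1 / 2 - 2 : ℝ) = (sinSq x + ε) ^ (-5 / 2 : ℝ) := by norm_num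
    have e1 : (sinSq x + ε) ^ (-1 / 2 - 1 : ℝ) =
        (sinSq x + ε) ^ (-5 / 2 : ℝ) * (sinSq x + ε) := by
      rw [← Real.rpow_add_one h0.ne']
      norm_num
    have e0 : (sinSq x + ε) ^ (-1 / 2 : ℝ) =
        (sinSq x + ε) ^ (-5 / 2 : ℝ) * (sinSq x + ε) ^ 2 := by
      rw [← Real.rpow_two, ← Real.rpow_add h0]
      norm_num
    simp only
    rw [e2, e1, e0, poleKernel]
    push_cast
    ring

theorem poleKernel_bounds {ε s : ℝ} (hε : 0 < ε) (hε1 : ε ≤ 1) (hs : 0 < s) (hs1 : s ≤ 1) :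
    |poleKernel ε s * √s| ≤ 1 * s⁻¹ := by
  have h0 : 0 < s + ε := by positivity
  have h1 : 0 ≤ 3 / 4 * ε - s * ε / 2 + ε ^ 2 / 4 := by nlinarith
  have h2 : 3 / 4 * ε - s * ε / 2 + ε ^ 2 / 4 ≤ s + ε := by nlinarith
  have e : (s + ε) ^ (-5 / 2 : ℝ) * (s + ε) = (s + ε) ^ (-3 / 2 : ℝ) := by
    rw [← Real.rpow_add_one h0.ne']
    norm_num
  have e2 : s ^ (-3 / 2 : ℝ) * √s = s⁻¹ := by
    rw [Real.sqrt_eq_rpow, ← Real.rpow_add hs, ← Real.rpow_neg_one]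
    norm_num
  rw [poleKernel, abs_of_nonneg (mul_nonneg (mul_nonneg (by positivity) h1) (by positivity)),
    one_mul, ← e2]
  refine mul_le_mul_of_nonneg_right ?_ (by positivity)
  calc _ ≤ (s + ε) ^ (-5 / 2 : ℝ) * (s + ε) := mul_le_mul_of_nonneg_left h2 (by positivity)
    _ = (s + ε) ^ (-3 / 2 : ℝ) := e
    _ ≤ s ^ (-3 / 2 : ℝ) := Real.rpow_le_rpow_of_nonpos hs (by linarith) (by norm_num)

/-- `sinSq^{-1/2}` is `1 / π` times the Green function of `Δ + 1/4` at the identity. -/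
theorem integral_sinSq_rpow_neg_half_mul {ψ : SO3 → ℂ} (hψ : IsSmooth ψ) :
    ∫ x, ((sinSq x ^ (-1 / 2 : ℝ) : ℝ) : ℂ) * (laplacian ψ x + 1 / 4 * ψ x) ∂μ =
      (Real.pi : ℂ)⁻¹ * ψ 1 := by
  have hlim : ∀ φ : SO3 → ℂ, IsSmooth φ → Filter.Tendsto
      (fun ε => ∫ x, (poleKernel ε (sinSq x) : ℂ) * φ x ∂μ) (nhdsWithin 0 (Set.Ioi 0))
      (nhds (∫ x, ((sinSq x ^ (-1 / 2 : ℝ) : ℝ) : ℂ) * (laplacian φ x + 1 / 4 * φ x) ∂μ)) := by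
    intro φ hφ
    have cφ : Continuous fun x => laplacian φ x + 1 / 4 * φ x :=
      (IsCk.continuous hφ.laplacian).add (continuous_const.mul (IsCk.continuous hφ))
    obtain ⟨M, hM⟩ := exists_norm_le cφ
    have hL := tendsto_integral_radial (H := fun ε s => (s + ε) ^ (-1 / 2 : ℝ))
      (H₀ := fun s => s ^ (-1 / 2 : ℝ)) (C := 2 ^ (-1 / 2 + 1 / 2 : ℝ)) (fun ε => by fun_prop)
      (fun ε hε hε1 s hs hs1 => by
        rw [abs_of_nonneg (by positivity)]
        exact rpow_add_le le_rfl hs hs1 hε hε1)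
      (fun s hs _ => tendsto_rpow_add _ hs) cφ.aestronglyMeasurable hM
    refine hL.congr' ?_
    filter_upwards [self_mem_nhdsWithin] with ε hε
    exact integral_rpow_add_mul_laplacian_add hε hφ
  have h1 := hlim (fun _ => 1) (isSmooth_const 1)
  have e1 : ∫ x, ((sinSq x ^ (-1 / 2 : ℝ) : ℝ) : ℂ) *
      (laplacian (fun _ => 1) x + 1 / 4 * 1) ∂μ = (Real.pi : ℂ)⁻¹ := by
    simp only [laplacian_const, zero_add, mul_one]
    rw [integral_mul_const, integral_complex_ofReal, integral_sinSq_rpow_neg_half]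
    push_cast
    ring
  rw [e1] at h1
  obtain ⟨C, hC⟩ := exists_norm_sub_one_le hψ
  have cψ : Continuous ψ := IsCk.continuous hψ
  have hC0 : 0 ≤ C := by
    by_contra! hneg
    obtain ⟨x, hx⟩ := sinSq_pos_ae.exists
    have := (norm_nonneg _).trans (hC x)
    nlinarith [Real.sqrt_pos.2 hx]
  have h2 := tendsto_integral_radial (H := fun ε s => poleKernel ε s * √s) (H₀ := fun _ => 0)
    (C := 1) (φ := fun x => (ψ x - ψ 1) / (√(sinSq x) : ℂ)) (M := C)
    (fun ε => by unfold poleKernel; fun_prop)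
    (fun ε hε hε1 s hs hs1 => poleKernel_bounds hε hε1 hs hs1)
    (fun s hs _ => by
      have h := tendsto_rpow_add (-5 / 2) hs
      have h' : Filter.Tendsto (fun ε : ℝ => 3 / 4 * ε - s * ε / 2 + ε ^ 2 / 4)
          (nhdsWithin 0 (Set.Ioi 0)) (nhds 0) := by
        have : Continuous fun ε : ℝ => 3 / 4 * ε - s * ε / 2 + ε ^ 2 / 4 := by fun_prop
        have h0 := this.tendsto 0
        simp only [mul_zero, zero_div, sub_zero, zero_pow two_ne_zero, add_zero] at h0
        exact h0.mono_left nhdsWithin_le_nhds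
      simpa [poleKernel] using (h.mul h').mul_const √s)
    (((cψ.sub continuous_const).measurable.div (Complex.measurable_ofReal.comp
      measurable_sinSq.sqrt)).aestronglyMeasurable)
    (fun x => by
      rw [norm_div, Complex.norm_real, Real.norm_of_nonneg (Real.sqrt_nonneg _)]
      exact div_le_of_le_mul₀ (Real.sqrt_nonneg _) hC0 (hC x))
  have h3 : Filter.Tendsto (fun ε => ∫ x, (poleKernel ε (sinSq x) : ℂ) * ψ x ∂μ)
      (nhdsWithin 0 (Set.Ioi 0)) (nhds ((Real.pi : ℂ)⁻¹ * ψ 1)) := by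
    have h4 := (h1.mul_const (ψ 1)).add h2
    simp only [Complex.ofReal_zero, zero_mul, integral_zero, add_zero] at h4
    refine h4.congr' ?_
    filter_upwards [self_mem_nhdsWithin] with ε hε
    have hε : 0 < ε := hε
    have cp : Continuous fun x => (poleKernel ε (sinSq x) : ℂ) := by
      have cr := continuous_sinSq_add_rpow hε (-5 / 2)
      have cs := continuous_sinSq
      unfold poleKernel
      fun_prop
    have e : ∫ x, ((poleKernel ε (sinSq x) * √(sinSq x) : ℝ) : ℂ) *
        ((ψ x - ψ 1) / (√(sinSq x) : ℂ)) ∂μ =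
        ∫ x, (poleKernel ε (sinSq x) : ℂ) * (ψ x - ψ 1) ∂μ := by
      refine integral_congr_ae (sinSq_pos_ae.mono fun x hx => ?_)
      have : (√(sinSq x) : ℂ) ≠ 0 := by
        exact_mod_cast (Real.sqrt_pos.2 hx).ne'
      push_cast
      field_simp
    have cd : Continuous fun x => ψ x - ψ 1 := cψ.sub continuous_const
    have cone : Continuous fun _ : SO3 => ψ 1 := continuous_const
    simp only [mul_one]
    rw [e, ← integral_mul_const, ← integral_add (integrable_mul cp cone)
      (integrable_mul cp cd)]
    exact integral_congr_ae (ae_of_all _ fun x => by ring)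
  exact tendsto_nhds_unique (hlim ψ hψ) h3

theorem IsSmooth.shiftedLaplacians {ψ : SO3 → ℂ} (hψ : IsSmooth ψ) (n : ℕ) :
    IsSmooth (shiftedLaplacians n ψ) := by
  induction n with
  | zero => exact hψ
  | succ n ih => exact IsCk.sub ih.laplacian (IsCk.const_mul _ ih)

theorem integral_sinSq_rpow_mul_shiftedLaplacians {ψ : SO3 → ℂ} (hψ : IsSmooth ψ) (n : ℕ) :
    ∫ x, ((sinSq x ^ ((n : ℝ) - 1 / 2) : ℝ) : ℂ) * shiftedLaplacians (n + 1) ψ x ∂μ =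
      (-1 / 4) ^ n * ((2 * n).factorial : ℂ) * ((Real.pi : ℂ)⁻¹ * ψ 1) := by
  induction n with
  | zero =>
    rw [← integral_sinSq_rpow_neg_half_mul hψ]
    simp only [shiftedLaplacians]
    norm_num
  | succ n ih =>
    have h := integral_sinSq_rpow_mul_laplacian_sub (a := n + 1 / 2)
      (by linarith [n.cast_nonneg (α := ℝ)]) (hψ.shiftedLaplacians (n + 1))
    have e1 : ((n + 1 : ℕ) : ℝ) - 1 / 2 = n + 1 / 2 := by push_cast; ring
    have e2 : (n : ℝ) + 1 / 2 - 1 = n - 1 / 2 := by ring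
    have e3 : ∀ x, shiftedLaplacians (n + 1 + 1) ψ x = laplacian (shiftedLaplacians (n + 1) ψ) x -
        (((n + 1 / 2) * (n + 1 / 2 + 1) : ℝ) : ℂ) * shiftedLaplacians (n + 1) ψ x := fun x => by
      rw [shiftedLaplacians]
      push_cast
      ring
    rw [e2, ih] at h
    rw [e1]
    simp only [e3]
    rw [h, show 2 * (n + 1) = (2 * n + 1) + 1 by ring, Nat.factorial_succ, Nat.factorial_succ,
      pow_succ]
    push_cast
    ring

/-- The radial profile `sin (ω / 2) ^ (2m - 3)` of the surface spline kernel. -/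
noncomputable def splineProfile (m : ℕ) (x : SO3) : ℝ := √(sinSq x) ^ (2 * m - 3)

theorem kernel_eq (m : ℕ) (x α : SO3) : kernel m x α = splineProfile m (α⁻¹ * x) := by
  rw [kernel, sin_half_angle, splineProfile]

theorem continuous_splineProfile (m : ℕ) : Continuous (splineProfile m) :=
  (Real.continuous_sqrt.comp continuous_sinSq).pow _

/-- The surface spline kernel is the Green function of `𝓛_m`. -/
theorem integral_splineProfile_mul_opL {m : ℕ} (hm : 2 ≤ m) {ψ : SO3 → ℂ} (hψ : IsSmooth ψ) :
    ∫ x, (splineProfile m x : ℂ) * opL m ψ x ∂μ = ψ 1 := by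
  obtain ⟨n, rfl⟩ : ∃ n, m = n + 2 := ⟨m - 2, by omega⟩
  have h := integral_sinSq_rpow_mul_shiftedLaplacians hψ (n + 1)
  have e : ∀ x, splineProfile (n + 2) x = sinSq x ^ (((n + 1 : ℕ) : ℝ) - 1 / 2) := fun x => by
    rw [splineProfile, ← Real.rpow_natCast, Real.sqrt_eq_rpow, ← Real.rpow_mul (sinSq_nonneg x),
      show 2 * (n + 2) - 3 = 2 * n + 1 by omega]
    congr 1
    push_cast
    ring
  simp only [e, opL, mul_left_comm (_ : ℂ) ((Real.pi : ℂ) * _ / _)]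
  rw [integral_const_mul, h, show n + 2 - 1 = n + 1 by omega,
    show 2 * (n + 2) - 2 = 2 * (n + 1) by omega]
  have hpi : (Real.pi : ℂ) ≠ 0 := by exact_mod_cast Real.pi_ne_zero
  have hf : ((2 * (n + 1)).factorial : ℂ) ≠ 0 := by exact_mod_cast Nat.factorial_ne_zero _
  have h4 : (-4 : ℂ) ^ (n + 1) * (-1 / 4) ^ (n + 1) = 1 := by
    rw [← mul_pow]
    norm_num
  calc _ = ((-4 : ℂ) ^ (n + 1) * (-1 / 4) ^ (n + 1)) * (Real.pi * (Real.pi : ℂ)⁻¹) *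
        (((2 * (n + 1)).factorial : ℂ) / ((2 * (n + 1)).factorial : ℂ)) * ψ 1 := by ring
    _ = ψ 1 := by rw [h4, mul_inv_cancel₀ hpi, div_self hf]; ring

/-! ### Test functions -/

/-- Functions whose left translates span a finite-dimensional space of smooth functions: these
are the polynomials in the matrix entries, in the form in which convolution with a class function
can be computed termwise. -/
def Splits (φ : SO3 → ℂ) : Prop :=
  ∃ (ι : Type) (_ : Fintype ι) (p q : ι → SO3 → ℂ), (∀ j, Continuous (p j)) ∧
    (∀ j, IsSmooth (q j)) ∧ ∀ y x, φ (y * x) = ∑ j, p j y * q j x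

theorem Splits.isSmooth {φ : SO3 → ℂ} (h : Splits φ) : IsSmooth φ := by
  obtain ⟨ι, _, p, q, -, hq, h⟩ := h
  have e : φ = fun x => ∑ j, p j 1 * q j x := funext fun x => by rw [← h, one_mul]
  rw [e]
  exact IsCk.sum fun j _ => IsCk.const_mul _ (hq j)

theorem Splits.continuous {φ : SO3 → ℂ} (h : Splits φ) : Continuous φ := IsCk.continuous h.isSmooth

theorem Splits.const (c : ℂ) : Splits fun _ => c :=
  ⟨Unit, inferInstance, fun _ _ => c, fun _ _ => 1, fun _ => continuous_const,
    fun _ => isSmooth_const 1, by simp⟩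

theorem Splits.add {φ ψ : SO3 → ℂ} (hφ : Splits φ) (hψ : Splits ψ) :
    Splits fun x => φ x + ψ x := by
  obtain ⟨ι, _, p, q, hp, hq, h⟩ := hφ
  obtain ⟨ι', _, p', q', hp', hq', h'⟩ := hψ
  exact ⟨ι ⊕ ι', inferInstance, Sum.elim p p', Sum.elim q q', fun j => by cases j <;> simp [hp, hp'],
    fun j => by cases j <;> simp [hq, hq'], fun y x => by simp [h, h']⟩

theorem Splits.mul {φ ψ : SO3 → ℂ} (hφ : Splits φ) (hψ : Splits ψ) :
    Splits fun x => φ x * ψ x := by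
  obtain ⟨ι, _, p, q, hp, hq, h⟩ := hφ
  obtain ⟨ι', _, p', q', hp', hq', h'⟩ := hψ
  refine ⟨ι × ι', inferInstance, fun j y => p j.1 y * p' j.2 y, fun j x => q j.1 x * q' j.2 x,
    fun j => (hp _).mul (hp' _), fun j => IsCk.mul (hq _) (hq' _), fun y x => ?_⟩
  dsimp only
  rw [h, h', Finset.sum_mul_sum, Fintype.sum_prod_type]
  exact Finset.sum_congr rfl fun _ _ => Finset.sum_congr rfl fun _ _ => by ring

theorem IsSmooth.conj {φ : SO3 → ℂ} (h : IsSmooth φ) :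
    IsSmooth fun x => (starRingEnd ℂ) (φ x) := by
  obtain ⟨F, hF, h⟩ := h
  exact ⟨fun A => (starRingEnd ℂ) (F A), Complex.conjCLE.contDiff.comp hF,
    fun x => congrArg (starRingEnd ℂ) (h x)⟩

theorem Splits.conj {φ : SO3 → ℂ} (hφ : Splits φ) :
    Splits fun x => (starRingEnd ℂ) (φ x) := by
  obtain ⟨ι, _, p, q, hp, hq, h⟩ := hφ
  exact ⟨ι, inferInstance, fun j y => (starRingEnd ℂ) (p j y), fun j x => (starRingEnd ℂ) (q j x),
    fun j => Complex.continuous_conj.comp (hp j), fun j => (hq j).conj, fun y x => by simp [h]⟩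

theorem Splits.entry (a b : Fin 3) : Splits (entry a b) := by
  refine ⟨Fin 3, inferInstance, fun c => SurfaceSpline.entry a c,
    fun c => SurfaceSpline.entry c b, fun c => IsCk.continuous (isSmooth_entry a c),
    fun c => isSmooth_entry c b, fun y x => ?_⟩
  have h : (y * x).1 a b = ∑ c, y.1 a c * x.1 c b := Matrix.mul_apply
  simp only [SurfaceSpline.entry, h]
  push_cast
  rfl

/-- The functions with `Splits` as a star subalgebra of the continuous functions. -/
def splitsAlgebra : StarSubalgebra ℂ C(SO3, ℂ) where
  carrier := {φ | Splits φ}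
  mul_mem' hφ hψ := Splits.mul hφ hψ
  one_mem' := Splits.const 1
  add_mem' hφ hψ := Splits.add hφ hψ
  zero_mem' := Splits.const 0
  algebraMap_mem' c := Splits.const c
  star_mem' hφ := Splits.conj hφ

theorem splitsAlgebra_dense : splitsAlgebra.topologicalClosure = ⊤ := by
  refine ContinuousMap.starSubalgebra_topologicalClosure_eq_top_of_separatesPoints _ ?_
  intro x y hxy
  obtain ⟨a, b, hab⟩ : ∃ a b, x.1 a b ≠ y.1 a b := by
    by_contra! h
    exact hxy (Subtype.ext (Matrix.ext h))
  refine ⟨entry a b, ⟨⟨entry a b, (Splits.entry a b).continuous⟩, Splits.entry a b, rfl⟩, ?_⟩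
  simpa [entry] using hab

/-- The fundamental lemma of the calculus of variations. -/
theorem ae_eq_zero_of_integral_mul_eq_zero {u : SO3 → ℂ} (hu : Integrable u μ)
    (h : ∀ φ, Splits φ → ∫ x, u x * φ x ∂μ = 0) : u =ᵐ[μ] 0 := by
  have hi : ∀ {φ : SO3 → ℂ}, Continuous φ → Integrable (fun x => u x * φ x) μ := fun hφ => by
    obtain ⟨M, hM⟩ := exists_norm_le hφ
    exact hu.mul_bdd hφ.aestronglyMeasurable (ae_of_all _ hM)
  have hc : ∀ φ : C(SO3, ℂ), ∫ x, u x * φ x ∂μ = 0 := fun φ => by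
    have hφ : φ ∈ splitsAlgebra.topologicalClosure := by
      rw [splitsAlgebra_dense]
      trivial
    rw [← norm_le_zero_iff]
    refine le_of_forall_pos_le_add fun ε hε => ?_
    set N := ∫ x, ‖u x‖ ∂μ
    have hN : 0 ≤ N := integral_nonneg fun x => norm_nonneg _
    obtain ⟨ψ, hψ, hd⟩ := Metric.mem_closure_iff.1 hφ (ε / (N + 1)) (by positivity)
    have e : ∫ x, u x * φ x ∂μ = ∫ x, u x * (φ x - ψ x) ∂μ := by
      simp only [mul_sub]
      rw [integral_sub (hi φ.continuous) (hi ψ.continuous), h ψ hψ, sub_zero]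
    rw [e, zero_add]
    calc _ ≤ ∫ x, ‖u x‖ * (ε / (N + 1)) ∂μ := by
          refine norm_integral_le_of_norm_le (hu.norm.mul_const _) (ae_of_all _ fun x => ?_)
          rw [norm_mul, ← dist_eq_norm (φ x)]
          exact mul_le_mul_of_nonneg_left ((ContinuousMap.dist_apply_le_dist x).trans hd.le)
            (norm_nonneg _)
      _ = N / (N + 1) * ε := by rw [integral_mul_const]; ring
      _ ≤ ε := mul_le_of_le_one_left hε.le ((div_le_one (by positivity)).2 (by linarith))
  refine ae_eq_zero_of_forall_setIntegral_isClosed_eq_zero hu fun s hs => ?_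
  have ht := tendsto_integral_of_dominated_convergence (μ := μ)
    (F := fun n x => u x * ((hs.apprSeq n x : ℝ) : ℂ))
    (f := s.indicator u) (bound := fun x => ‖u x‖)
    (fun n => (hi (φ := fun x => ((hs.apprSeq n x : ℝ) : ℂ))
      (by fun_prop)).aestronglyMeasurable) hu.norm
    (fun n => ae_of_all _ fun x => by
      rw [norm_mul, Complex.norm_real, Real.norm_of_nonneg NNReal.zero_le_coe]
      exact mul_le_of_le_one_right (norm_nonneg _)
        (by exact_mod_cast HasOuterApproxClosed.apprSeq_apply_le_one hs n x))
    (ae_of_all _ fun x => by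
      have h1 := (tendsto_pi_nhds.1 (HasOuterApproxClosed.tendsto_apprSeq hs)) x
      have h2 : Filter.Tendsto (fun n => ((hs.apprSeq n x : ℝ) : ℂ)) Filter.atTop
          (nhds (((s.indicator (fun _ => (1 : NNReal)) x : NNReal) : ℝ) : ℂ)) :=
        ((Complex.continuous_ofReal.comp NNReal.continuous_coe).tendsto _).comp h1
      have h3 := h2.const_mul (u x)
      convert h3 using 2
      by_cases hx : x ∈ s <;> simp [hx])
  have hz : ∀ n, ∫ x, u x * ((hs.apprSeq n x : ℝ) : ℂ) ∂μ = 0 := fun n =>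
    hc ⟨fun x => ((hs.apprSeq n x : ℝ) : ℂ), by fun_prop⟩
  simp only [hz] at ht
  rw [← integral_indicator hs.measurableSet]
  exact tendsto_nhds_unique ht tendsto_const_nhds

/-! ### The spline operator in terms of iterated derivatives -/

theorem exists_word_expansion_shiftedLaplacians (n : ℕ) :
    ∃ (ι : Type) (_ : Fintype ι) (W : ι → List (Fin 3)) (c : ι → ℂ),
      (∀ j, (W j).length ≤ 2 * n) ∧ ∀ φ, IsSmooth φ →
        shiftedLaplacians n φ = fun x => ∑ j, c j * XWord (W j) φ x := by
  induction n with
  | zero =>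
    exact ⟨Unit, inferInstance, fun _ => [], fun _ => 1, by simp, fun φ _ => by
      simp [shiftedLaplacians, XWord]⟩
  | succ n ih =>
    obtain ⟨ι, _, W, c, hW, h⟩ := ih
    refine ⟨(Fin 3 × ι) ⊕ ι, inferInstance, Sum.elim (fun k => k.1 :: k.1 :: W k.2) W,
      Sum.elim (fun k => -c k.2) (fun j => -(((n : ℂ) ^ 2 - 1 / 4) * c j)), ?_, fun φ hφ => ?_⟩
    · rintro (k | k)
      · have := hW k.2
        simp
        omega
      · have := hW k
        simp
        omega
    · have hX : ∀ i, X i (X i (shiftedLaplacians n φ)) =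
          fun x => ∑ j, c j * X i (X i (XWord (W j) φ)) x := fun i => by
        rw [h φ hφ, X_sum fun j _ => IsCk.const_mul _ (hφ.XWord _)]
        simp only [X_const_mul _ (hφ.XWord _)]
        rw [X_sum fun j _ => IsCk.const_mul _ ((hφ.XWord _).X i)]
        simp only [X_const_mul _ ((hφ.XWord _).X i)]
      funext x
      simp only [shiftedLaplacians, laplacian, hX]
      simp only [h φ hφ, Fintype.sum_sum_type, Fintype.sum_prod_type, Sum.elim_inl, Sum.elim_inr,
        Finset.mul_sum, sub_eq_add_neg, ← Finset.sum_neg_distrib]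
      congr 1
      · exact Finset.sum_congr rfl fun i _ => Finset.sum_congr rfl fun j _ => by
          simp [XWord]
      · exact Finset.sum_congr rfl fun j _ => by ring

theorem exists_word_expansion_opL (m : ℕ) :
    ∃ (ι : Type) (_ : Fintype ι) (W : ι → List (Fin 3)) (c : ι → ℂ),
      (∀ j, (W j).length ≤ 2 * m) ∧ ∀ φ, IsSmooth φ →
        opL m φ = fun x => ∑ j, c j * XWord (W j) φ x := by
  obtain ⟨ι, _, W, c, hW, h⟩ := exists_word_expansion_shiftedLaplacians m
  refine ⟨ι, inferInstance, W,
    fun j => (Real.pi : ℂ) * (-4) ^ (m - 1) / ((2 * m - 2).factorial : ℂ) * c j, hW,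
    fun φ hφ => funext fun x => ?_⟩
  rw [opL, h φ hφ, Finset.mul_sum]
  exact Finset.sum_congr rfl fun j _ => by ring

theorem opL_sum {ι : Type*} [Fintype ι] (m : ℕ) (b : ι → ℂ) {q : ι → SO3 → ℂ}
    (hq : ∀ j, IsSmooth (q j)) :
    opL m (fun x => ∑ j, b j * q j x) = fun x => ∑ j, b j * opL m (q j) x := by
  obtain ⟨κ, _, W, c, -, h⟩ := exists_word_expansion_opL m
  rw [h _ (IsCk.sum fun j _ => IsCk.const_mul _ (hq j))]
  funext x
  simp only [XWord_sum fun j _ => IsCk.const_mul _ (hq j), XWord_const_mul _ (hq _), h _ (hq _),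
    Finset.mul_sum]
  rw [Finset.sum_comm]
  exact Finset.sum_congr rfl fun _ _ => Finset.sum_congr rfl fun _ _ => by ring

theorem shiftedLaplacians_comp_mul_left (n : ℕ) (y : SO3) (φ : SO3 → ℂ) :
    shiftedLaplacians n (fun x => φ (y * x)) = fun x => shiftedLaplacians n φ (y * x) := by
  induction n with
  | zero => rfl
  | succ n ih =>
    funext x
    simp only [shiftedLaplacians, ih, laplacian_comp_mul_left y (shiftedLaplacians n φ)]

theorem opL_comp_mul_left (m : ℕ) (y : SO3) (φ : SO3 → ℂ) :
    opL m (fun x => φ (y * x)) = fun x => opL m φ (y * x) := by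
  funext x
  simp only [opL, shiftedLaplacians_comp_mul_left]

/-! ### Inversion of the spline operator -/

theorem sinSq_conj (α y : SO3) : sinSq (α⁻¹ * (y * α)) = sinSq y := by
  have h : (α⁻¹ * (y * α)).1.trace = y.1.trace := by
    change ((α⁻¹).1 * (y.1 * α.1)).trace = _
    rw [Matrix.trace_mul_comm, mul_assoc]
    change (y * (α * α⁻¹)).1.trace = _
    rw [mul_inv_cancel, mul_one]
  rw [sinSq, h, sinSq]

theorem integral_splineProfile_mul_comm (m : ℕ) (α : SO3) (ψ : SO3 → ℂ) :
    ∫ y, (splineProfile m y : ℂ) * ψ (y * α) ∂μ = ∫ y, (splineProfile m y : ℂ) * ψ (α * y) ∂μ := by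
  rw [← integral_mul_left_eq_self (fun y => (splineProfile m y : ℂ) * ψ (α * y)) α⁻¹,
    ← integral_mul_right_eq_self (fun y => (splineProfile m (α⁻¹ * y) : ℂ) * ψ (α * (α⁻¹ * y))) α]
  simp only [splineProfile, sinSq_conj, mul_inv_cancel_left]

/-- The integral operator with the surface spline kernel, the inverse of `𝓛_m`. -/
noncomputable def greenOp (m : ℕ) (φ : SO3 → ℂ) (α : SO3) : ℂ :=
  ∫ x, (kernel m x α : ℂ) * φ x ∂μ

theorem greenOp_eq (m : ℕ) (φ : SO3 → ℂ) (α : SO3) :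
    greenOp m φ α = ∫ y, (splineProfile m y : ℂ) * φ (y * α) ∂μ := by
  rw [integral_splineProfile_mul_comm, greenOp,
    ← integral_mul_left_eq_self (fun x => (kernel m x α : ℂ) * φ x) α]
  simp only [kernel_eq, inv_mul_cancel_left]

theorem continuous_ofReal_splineProfile (m : ℕ) : Continuous fun x => (splineProfile m x : ℂ) :=
  Complex.continuous_ofReal.comp (continuous_splineProfile m)

theorem greenOp_eq_sum (m : ℕ) {φ : SO3 → ℂ} {ι : Type} [Fintype ι] {p q : ι → SO3 → ℂ}
    (hp : ∀ j, Continuous (p j)) (h : ∀ y x, φ (y * x) = ∑ j, p j y * q j x) :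
    greenOp m φ = fun α => ∑ j, (∫ y, (splineProfile m y : ℂ) * p j y ∂μ) * q j α := by
  funext α
  rw [greenOp_eq]
  simp only [h, Finset.mul_sum, ← mul_assoc]
  rw [integral_finsetSum _ fun j _ =>
    (integrable_mul (continuous_ofReal_splineProfile m) (hp j)).mul_const _]
  simp only [integral_mul_const]

theorem Splits.isSmooth_greenOp (m : ℕ) {φ : SO3 → ℂ} (hφ : Splits φ) :
    IsSmooth (greenOp m φ) := by
  obtain ⟨ι, _, p, q, hp, hq, h⟩ := hφ
  rw [greenOp_eq_sum m hp h]
  exact IsCk.sum fun j _ => IsCk.const_mul _ (hq j)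

theorem Splits.opL_greenOp {m : ℕ} (hm : 2 ≤ m) {φ : SO3 → ℂ} (hφ : Splits φ) :
    opL m (greenOp m φ) = φ := by
  have hs := hφ.isSmooth
  obtain ⟨ι, _, p, q, hp, hq, h⟩ := hφ
  rw [greenOp_eq_sum m hp h, opL_sum m _ hq]
  funext α
  have e : ∀ y, opL m φ (y * α) = ∑ j, p j y * opL m (q j) α := fun y => by
    have h1 := congrFun (opL_comp_mul_left m y φ) α
    simp only [h, opL_sum m _ hq] at h1
    exact h1.symm
  have hsα : IsSmooth fun y => φ (α * y) := by
    simp only [h]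
    exact IsCk.sum fun j _ => IsCk.const_mul _ (hq j)
  calc _ = ∫ y, (splineProfile m y : ℂ) * opL m φ (y * α) ∂μ := by
        simp only [e, Finset.mul_sum, ← mul_assoc]
        rw [integral_finsetSum _ fun j _ =>
          (integrable_mul (continuous_ofReal_splineProfile m) (hp j)).mul_const _]
        simp only [integral_mul_const]
    _ = ∫ y, (splineProfile m y : ℂ) * opL m (fun y => φ (α * y)) y ∂μ := by
        rw [integral_splineProfile_mul_comm, opL_comp_mul_left]
    _ = φ α := by rw [integral_splineProfile_mul_opL hm hsα, mul_one]

theorem continuous_kernel (m : ℕ) : Continuous fun z : SO3 × SO3 => (kernel m z.1 z.2 : ℂ) := by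
  simp only [kernel_eq]
  exact (continuous_ofReal_splineProfile m).comp (continuous_snd.inv.mul continuous_fst)

theorem norm_kernel_le (m : ℕ) (x α : SO3) : ‖(kernel m x α : ℂ)‖ ≤ 1 := by
  rw [kernel_eq, splineProfile, Complex.norm_real, Real.norm_of_nonneg (by positivity)]
  exact pow_le_one₀ (Real.sqrt_nonneg _) (Real.sqrt_le_one.2 (sinSq_le_one _))

/-- A function is the spline potential of its image under `𝓛_m`. -/
theorem ae_eq_integral_kernel {m : ℕ} (hm : 2 ≤ m) {g v : SO3 → ℂ} (hg : Integrable g μ)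
    (hv : Integrable v μ) (h : IsWeakL m g v) :
    g =ᵐ[μ] fun x => ∫ α, v α * (kernel m x α : ℂ) ∂μ := by
  have hprod : Integrable (fun z : SO3 × SO3 => v z.2 * (kernel m z.1 z.2 : ℂ)) (μ.prod μ) :=
    (hv.comp_snd μ).mul_bdd (continuous_kernel m).aestronglyMeasurable
      (ae_of_all _ fun z => norm_kernel_le m z.1 z.2)
  have hR : Integrable (fun x => ∫ α, v α * (kernel m x α : ℂ) ∂μ) μ := hprod.integral_prod_left
  have key : (fun x => g x - ∫ α, v α * (kernel m x α : ℂ) ∂μ) =ᵐ[μ] 0 := by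
    refine ae_eq_zero_of_integral_mul_eq_zero (hg.sub hR) fun φ hφ => ?_
    obtain ⟨M, hM⟩ := exists_norm_le hφ.continuous
    have hbdd : ∀ {u : SO3 → ℂ}, Integrable u μ → Integrable (fun x => u x * φ x) μ := fun hu =>
      hu.mul_bdd hφ.continuous.aestronglyMeasurable (ae_of_all _ hM)
    have h1 : ∫ x, g x * φ x ∂μ = ∫ α, v α * greenOp m φ α ∂μ := by
      rw [← h _ (hφ.isSmooth_greenOp m), hφ.opL_greenOp hm]
    have h2 : ∫ x, (∫ α, v α * (kernel m x α : ℂ) ∂μ) * φ x ∂μ =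
        ∫ α, v α * greenOp m φ α ∂μ := by
      have hprod' : Integrable (Function.uncurry fun x α : SO3 =>
          v α * (kernel m x α : ℂ) * φ x) (μ.prod μ) :=
        hprod.mul_bdd (hφ.continuous.comp continuous_fst).aestronglyMeasurable
          (ae_of_all _ fun z => hM z.1)
      simp only [← integral_mul_const]
      rw [integral_integral_swap hprod']
      refine integral_congr_ae (ae_of_all _ fun α => ?_)
      simp only [greenOp, mul_assoc, integral_const_mul]
    simp only [sub_mul]
    rw [integral_sub (hbdd hg) (hbdd hR), h1, h2, sub_self]
  exact key.mono fun x hx => sub_eq_zero.1 hx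

/-! ### Weak derivatives and the spline operator on Sobolev spaces -/

theorem integrable_mul_smooth {u φ : SO3 → ℂ} (hu : Integrable u μ) (hφ : IsSmooth φ) :
    Integrable (fun x => u x * φ x) μ := by
  obtain ⟨M, hM⟩ := exists_norm_le (IsCk.continuous hφ)
  exact hu.mul_bdd (IsCk.continuous hφ).aestronglyMeasurable (ae_of_all _ hM)

theorem ae_eq_of_integral_mul_smooth {u v : SO3 → ℂ} (hu : Integrable u μ) (hv : Integrable v μ)
    (h : ∀ φ, IsSmooth φ → ∫ x, u x * φ x ∂μ = ∫ x, v x * φ x ∂μ) : u =ᵐ[μ] v := by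
  have key : (fun x => u x - v x) =ᵐ[μ] 0 := by
    refine ae_eq_zero_of_integral_mul_eq_zero (hu.sub hv) fun φ hφ => ?_
    simp only [sub_mul]
    rw [integral_sub (integrable_mul_smooth hu hφ.isSmooth)
      (integrable_mul_smooth hv hφ.isSmooth), h φ hφ.isSmooth, sub_self]
  exact key.mono fun x hx => sub_eq_zero.1 hx

theorem weakDeriv_spec {w : List (Fin 3)} {f u : SO3 → ℂ} (hu : Integrable u μ)
    (h : IsWeakDeriv w f u) : Integrable (weakDeriv w f) μ ∧ IsWeakDeriv w f (weakDeriv w f) := by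
  have hex : ∃ u, Integrable u μ ∧ IsWeakDeriv w f u := ⟨u, hu, h⟩
  rw [weakDeriv, dif_pos hex]
  exact hex.choose_spec

theorem weakDeriv_ae_eq {w : List (Fin 3)} {f u : SO3 → ℂ} (hu : Integrable u μ)
    (h : IsWeakDeriv w f u) : weakDeriv w f =ᵐ[μ] u := by
  obtain ⟨hi, hw⟩ := weakDeriv_spec hu h
  refine ae_eq_of_integral_mul_smooth hi hu fun φ hφ => ?_
  have e := (hw φ hφ).symm.trans (h φ hφ)
  exact mul_left_cancel₀ (pow_ne_zero _ (neg_ne_zero.2 one_ne_zero)) e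

theorem weakL_spec {m : ℕ} {f u : SO3 → ℂ} (hu : Integrable u μ) (h : IsWeakL m f u) :
    Integrable (weakL m f) μ ∧ IsWeakL m f (weakL m f) := by
  have hex : ∃ u, Integrable u μ ∧ IsWeakL m f u := ⟨u, hu, h⟩
  rw [weakL, dif_pos hex]
  exact hex.choose_spec

theorem weakL_ae_eq {m : ℕ} {f u : SO3 → ℂ} (hu : Integrable u μ) (h : IsWeakL m f u) :
    weakL m f =ᵐ[μ] u := by
  obtain ⟨hi, hw⟩ := weakL_spec hu h
  exact ae_eq_of_integral_mul_smooth hi hu fun φ hφ => (hw φ hφ).symm.trans (h φ hφ)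

/-- A function in `W_p^k` has weak derivatives up to order `k`, with norms bounded by its Sobolev
norm. -/
theorem MemW.exists_weakDeriv {p : ℝ≥0∞} (hp : 1 ≤ p) {k : ℕ} {g : SO3 → ℂ} (hg : MemW p k g)
    {w : List (Fin 3)} (hw : w.length ≤ k) :
    ∃ u, Integrable u μ ∧ IsWeakDeriv w g u ∧ eLpNorm u p μ ≤ normW p k g := by
  by_cases hpt : p = ∞
  · rw [MemW, if_pos hpt] at hg
    have hgw : IsCk ((w.length + 0 : ℕ) : ℕ∞) g := hg.of_le (by exact_mod_cast hw)
    have hc : IsCk ((0 : ℕ) : ℕ∞) (XWord w g) := hgw.XWord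
    refine ⟨XWord w g, integrable_of_continuous hc.continuous, IsCk.isWeakDeriv hgw, ?_⟩
    rw [normW, if_pos hpt, hpt, eLpNorm_exponent_top]
    refine eLpNormEssSup_le_of_ae_enorm_bound (ae_of_all _ fun x => ?_)
    exact le_iSup_of_le w (le_iSup_of_le hw (le_iSup (fun x => ‖XWord w g x‖ₑ) x))
  · rw [MemW, if_neg hpt] at hg
    obtain ⟨u, hu, hwu⟩ := hg.2 w hw
    obtain ⟨hi, hd⟩ := weakDeriv_spec (hu.integrable hp) hwu
    refine ⟨_, hi, hd, ?_⟩
    have hp0 : 0 < p.toReal := ENNReal.toReal_pos (zero_lt_one.trans_le hp).ne' hpt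
    rw [normW, if_neg hpt, one_div, ENNReal.le_rpow_inv_iff hp0]
    refine le_trans ?_ (Finset.single_le_sum (f := fun r => ∑ w : Fin r → Fin 3,
      eLpNorm (weakDeriv (List.ofFn w) g) p μ ^ p.toReal) (fun _ _ => zero_le)
      (Finset.mem_range.2 (Nat.lt_succ_of_le hw)))
    refine le_trans (le_of_eq ?_) (Finset.single_le_sum (f := fun w : Fin w.length → Fin 3 =>
      eLpNorm (weakDeriv (List.ofFn w) g) p μ ^ p.toReal) (fun _ _ => zero_le)
      (Finset.mem_univ w.get))
    simp only [List.ofFn_get]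

theorem MemW.integrable {p : ℝ≥0∞} (hp : 1 ≤ p) {k : ℕ} {g : SO3 → ℂ} (hg : MemW p k g) :
    Integrable g μ := by
  by_cases hpt : p = ∞
  · rw [MemW, if_pos hpt] at hg
    exact integrable_of_continuous hg.continuous
  · rw [MemW, if_neg hpt] at hg
    exact hg.1.integrable hp

theorem isWeakDeriv_nil (g : SO3 → ℂ) : IsWeakDeriv [] g g := fun φ _ => by simp [XWord]

theorem MemW.eLpNorm_le {p : ℝ≥0∞} (hp : 1 ≤ p) {k : ℕ} {g : SO3 → ℂ} (hg : MemW p k g) :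
    eLpNorm g p μ ≤ normW p k g := by
  obtain ⟨u, hu, hw, hn⟩ := hg.exists_weakDeriv hp (w := []) (Nat.zero_le _)
  have e : g =ᵐ[μ] u := (weakDeriv_ae_eq (hg.integrable hp) (isWeakDeriv_nil g)).symm.trans
    (weakDeriv_ae_eq hu hw)
  rwa [eLpNorm_congr_ae e]

/-- `𝓛_m` is bounded from `W_p^{2m}` to `L_p`, uniformly in `p`. -/
theorem exists_eLpNorm_weakL_le (m : ℕ) : ∃ C : ℝ, 0 ≤ C ∧ ∀ (p : ℝ≥0∞), 1 ≤ p →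
    ∀ g, MemW p (2 * m) g → Integrable (weakL m g) μ ∧ IsWeakL m g (weakL m g) ∧
      eLpNorm (weakL m g) p μ ≤ ENNReal.ofReal C * normW p (2 * m) g := by
  obtain ⟨ι, _, W, c, hW, h⟩ := exists_word_expansion_opL m
  refine ⟨∑ j, ‖c j‖, Finset.sum_nonneg fun j _ => norm_nonneg _, fun p hp g hg => ?_⟩
  have hgi := hg.integrable hp
  choose u hui huw hun using fun j => hg.exists_weakDeriv hp (w := (W j).reverse)
    (by simpa using hW j)
  let s : ι → ℂ := fun j => c j * (-1) ^ (W j).length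
  have hvi : Integrable (fun x => ∑ j, s j * u j x) μ :=
    integrable_finsetSum _ fun j _ => (hui j).const_mul _
  have hv : IsWeakL m g (fun x => ∑ j, s j * u j x) := by
    intro φ hφ
    simp only [h φ hφ, Finset.mul_sum, Finset.sum_mul]
    rw [integral_finsetSum _ fun j _ =>
        integrable_mul_smooth hgi (IsCk.const_mul (c j) (hφ.XWord (W j))),
      integral_finsetSum _ fun j _ => integrable_mul_smooth ((hui j).const_mul (s j)) hφ]
    refine Finset.sum_congr rfl fun j _ => ?_
    have h1 := huw j φ hφ
    rw [List.reverse_reverse, List.length_reverse] at h1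
    simp only [mul_left_comm _ (c j), mul_assoc (s j), integral_const_mul, h1, s]
    ring
  obtain ⟨h1, h2⟩ := weakL_spec hvi hv
  refine ⟨h1, h2, ?_⟩
  rw [eLpNorm_congr_ae (weakL_ae_eq hvi hv)]
  calc eLpNorm (fun x => ∑ j, s j * u j x) p μ
      ≤ ∑ j, eLpNorm (fun x => s j * u j x) p μ := by
        have := eLpNorm_sum_le (s := Finset.univ) (f := fun j x => s j * u j x) (μ := μ)
          (fun j _ => ((hui j).const_mul (s j)).aestronglyMeasurable) hp
        convert this using 2
        ext x
        simp
    _ ≤ ∑ j, ENNReal.ofReal ‖c j‖ * normW p (2 * m) g := by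
        refine Finset.sum_le_sum fun j _ => ?_
        refine (eLpNorm_const_smul_le (c := s j) (f := u j)).trans ?_
        have e : ‖s j‖ₑ = ENNReal.ofReal ‖c j‖ := by
          rw [ofReal_norm]
          simp [s, enorm_mul, enorm_pow]
        rw [e]
        exact mul_le_mul_right (hun j) _
    _ = _ := by rw [← Finset.sum_mul, ENNReal.ofReal_sum_of_nonneg fun j _ => norm_nonneg _]

/-! ### The error kernel -/

/-- The chordal distance `sin (dist(x, α) / 2)`. -/
noncomputable def chord (x α : SO3) : ℝ := √(sinSq (α⁻¹ * x))

theorem chord_eq_dist (x α : SO3) :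
    chord x α = dist (WithLp.toLp 2 fun k : Fin 3 × Fin 3 => x.1 k.1 k.2 : EuclideanSpace ℝ _)
      (WithLp.toLp 2 fun k : Fin 3 × Fin 3 => α.1 k.1 k.2) / √8 := by
  rw [chord, sinSq_inv_mul, Real.sqrt_div (Finset.sum_nonneg fun a _ => Finset.sum_nonneg fun b _ =>
    sq_nonneg _), EuclideanSpace.dist_eq]
  simp [Fintype.sum_prod_type, Real.dist_eq, sq_abs]

theorem chord_comm (x α : SO3) : chord x α = chord α x := by
  rw [chord_eq_dist, chord_eq_dist, dist_comm]

theorem chord_triangle (x y z : SO3) : chord x z ≤ chord x y + chord y z := by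
  simp only [chord_eq_dist, ← add_div]
  gcongr
  exact dist_triangle _ _ _

theorem chord_nonneg (x α : SO3) : 0 ≤ chord x α := Real.sqrt_nonneg _

theorem chord_sq (x α : SO3) : chord x α ^ 2 = sinSq (α⁻¹ * x) := Real.sq_sqrt (sinSq_nonneg _)

theorem chord_le_of_rotDist_le {α ξ : SO3} {ρ : ℝ} (h : rotDist α ξ ≤ ρ) :
    chord α ξ ≤ ρ / 2 := by
  have h1 := sqrt_sinSq_le (ξ⁻¹ * α)
  rw [rotDist] at h
  rw [chord]
  linarith

/-- The binomial expansion with remainder. -/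
theorem exists_one_add_rpow_approx (b : ℝ) (N : ℕ) : ∃ (c : ℕ → ℝ) (C : ℝ), 0 ≤ C ∧
    ∀ z : ℝ, |z| < 3 / 4 →
      |(1 + z) ^ b - ∑ k ∈ Finset.range N, c k * z ^ k| ≤ C * |z| ^ N := by
  obtain ⟨a, ha, C, hC, h⟩ := (Real.one_add_rpow_hasFPowerSeriesOnBall_zero
    (a := b)).uniform_geometric_approx' (r' := 3 / 4) (by
      rw [← ENNReal.coe_one, ENNReal.coe_lt_coe]
      rw [← NNReal.coe_lt_coe]
      norm_num)
  refine ⟨fun k => Ring.choose b k, C * (a / (3 / 4)) ^ N, ?_, fun z hz => ?_⟩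
  · have := ha.1
    positivity
  · have h1 := h z (by simpa using hz) N
    have e : (binomialSeries ℝ b).partialSum N z =
        ∑ k ∈ Finset.range N, Ring.choose b k * z ^ k := by
      simp only [FormalMultilinearSeries.partialSum, binomialSeries_apply]
      simp
    rw [e, zero_add, Real.norm_eq_abs, Real.norm_eq_abs] at h1
    refine h1.trans (le_of_eq ?_)
    have e2 : (((3 / 4 : NNReal) : ℝ)) = 3 / 4 := by simp
    rw [e2, mul_assoc, ← mul_pow]
    congr 2
    ring

theorem affine_mul_mem_entryPoly {n : ℕ} {f : SO3 → ℂ} (hf : f ∈ entryPoly n) (c : ℂ)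
    (A : Fin 3 → Fin 3 → ℂ) :
    (fun x => (c + ∑ a, ∑ b, A a b * entry a b x) * f x) ∈ entryPoly (n + 1) := by
  have h : (fun x => (c + ∑ a, ∑ b, A a b * entry a b x) * f x) =
      c • f + ∑ a, ∑ b, A a b • fun x => entry a b x * f x := by
    funext x
    simp only [Pi.add_apply, Pi.smul_apply, Finset.sum_apply, smul_eq_mul, add_mul, Finset.sum_mul,
      mul_assoc]
  rw [h]
  exact Submodule.add_mem _ (Submodule.smul_mem _ _ (entryPoly_le_succ n hf))
    (Submodule.sum_mem _ fun a _ => Submodule.sum_mem _ fun b _ =>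
      Submodule.smul_mem _ _ (entry_mul_mem hf a b))

theorem affine_pow_mem_entryPoly (c : ℂ) (A : Fin 3 → Fin 3 → ℂ) (k : ℕ) :
    (fun x => (c + ∑ a, ∑ b, A a b * entry a b x) ^ k) ∈ entryPoly k := by
  induction k with
  | zero => simpa using const_mem_entryPoly 0 1
  | succ k ih => simpa only [pow_succ'] using affine_mul_mem_entryPoly ih c A

/-- As a function of `ξ`, the squared chordal distance is affine in the matrix entries, so a
polynomial of degree `n` in it belongs to `Π_n`. -/
theorem sum_chord_sq_pow_mem (x : SO3) (u w s : ℂ) (c : ℕ → ℂ) (n : ℕ) :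
    (fun ξ => s * ∑ k ∈ Finset.range (n + 1), c k * (u + w * ((chord x ξ ^ 2 : ℝ) : ℂ)) ^ k) ∈
      polynomials n := by
  have e : ∀ ξ : SO3, u + w * ((chord x ξ ^ 2 : ℝ) : ℂ) =
      (u + w * (3 / 4)) + ∑ a, ∑ b, (-(w / 4) * (x.1 a b : ℂ)) * entry a b ξ := fun ξ => by
    have h1 : (ξ⁻¹ * x).1.trace = ∑ a, ∑ b, ξ.1 a b * x.1 a b := by
      change (ξ.1.transpose * x.1).trace = _
      simp only [Matrix.trace, Matrix.diag, Matrix.mul_apply, Matrix.transpose_apply]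
      exact Finset.sum_comm
    rw [chord_sq, sinSq, h1]
    simp only [mul_assoc, ← Finset.mul_sum, entry]
    have h2 : ∑ a, ∑ b, (x.1 a b : ℂ) * (ξ.1 a b : ℂ) =
        ((∑ a, ∑ b, ξ.1 a b * x.1 a b : ℝ) : ℂ) := by
      push_cast
      exact Finset.sum_congr rfl fun a _ => Finset.sum_congr rfl fun b _ => mul_comm _ _
    rw [h2]
    push_cast
    ring
  simp only [e]
  refine entryPoly_le_polynomials n ?_
  have h : (fun ξ : SO3 => s * ∑ k ∈ Finset.range (n + 1), c k *
      ((u + w * (3 / 4)) + ∑ a, ∑ b, (-(w / 4) * (x.1 a b : ℂ)) * entry a b ξ) ^ k) =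
      s • ∑ k ∈ Finset.range (n + 1), c k • fun ξ : SO3 =>
        ((u + w * (3 / 4)) + ∑ a, ∑ b, (-(w / 4) * (x.1 a b : ℂ)) * entry a b ξ) ^ k := by
    funext ξ
    simp only [Pi.smul_apply, Finset.sum_apply, smul_eq_mul]
  rw [h]
  exact Submodule.smul_mem _ _ (Submodule.sum_mem _ fun k hk => Submodule.smul_mem _ _
    (entryPoly_mono (Nat.lt_succ_iff.1 (Finset.mem_range.1 hk)) (affine_pow_mem_entryPoly _ _ k)))

theorem kernel_eq_chord_pow (m : ℕ) (x α : SO3) : kernel m x α = chord x α ^ (2 * m - 3) := by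
  rw [kernel_eq, splineProfile, chord]

theorem CoefficientKernel.abs_sum_le {Ξ : Finset SO3} {a : Ξ → SO3 → ℝ} {ρ K : ℝ} {L : ℕ}
    (h : CoefficientKernel Ξ a ρ L K) (α : SO3) {R : SO3 → ℝ} {B : ℝ}
    (hR : ∀ ξ, rotDist α ξ ≤ ρ → |R ξ| ≤ B) (hB : 0 ≤ B) : |∑ ξ : Ξ, a ξ α * R ξ| ≤ K * B := by
  calc _ ≤ ∑ ξ : Ξ, |a ξ α| * B := by
        refine (Finset.abs_sum_le_sum_abs _ _).trans (Finset.sum_le_sum fun ξ _ => ?_)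
        rw [abs_mul]
        by_cases hξ : rotDist α ξ ≤ ρ
        · exact mul_le_mul_of_nonneg_left (hR ξ hξ) (abs_nonneg _)
        · simp [h.support ξ α (not_le.1 hξ)]
    _ ≤ K * B := by
        rw [← Finset.sum_mul]
        exact mul_le_mul_of_nonneg_right (h.stability α) hB

/-- The error kernel decays like the fourth inverse power of the distance: near the diagonal both
terms are small, and away from it the coefficients reproduce the Taylor polynomial of degree `2m`
of the kernel. -/
theorem exists_errorKernel_le {m : ℕ} (hm : 2 ≤ m) (K : ℝ) : ∃ C : ℝ, 0 ≤ C ∧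
    ∀ (Ξ : Finset SO3) (a : Ξ → SO3 → ℝ) (ρ : ℝ) (L : ℕ), 0 < ρ → 2 * m ≤ L →
      CoefficientKernel Ξ a ρ L K → ∀ x α : SO3,
        |kernel m x α - ∑ ξ : Ξ, a ξ α * kernel m x ξ| ≤
          C * ρ ^ (2 * m + 1) * ((sinSq (α⁻¹ * x) + ρ ^ 2) ^ 2)⁻¹ := by
  obtain ⟨n, hn⟩ : ∃ n, 2 * m - 3 = n := ⟨_, rfl⟩
  have hn4 : 2 * m + 1 = n + 4 := by omega
  obtain ⟨c, C₀, hC₀, happ⟩ := exists_one_add_rpow_approx ((n : ℝ) / 2) (2 * m + 1)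
  set C₁ : ℝ := C₀ * (9 / 8) ^ (n + 4) * (25 / 16)
  set C₂ : ℝ := 3 ^ n * 25
  have hC₁ : 0 ≤ C₁ := by positivity
  have hC₂ : 0 ≤ C₂ := by positivity
  refine ⟨(1 + |K|) * (C₁ + C₂), by positivity, fun Ξ a ρ L hρ hL ha x α => ?_⟩
  have hK : 0 ≤ 1 + K := by linarith [ha.one_le]
  have hKK : 1 + K ≤ 1 + |K| := by linarith [le_abs_self K]
  simp only [kernel_eq_chord_pow, hn]
  rw [hn4, ← chord_sq]
  set r := chord x α with hr
  have hr0 : 0 ≤ r := chord_nonneg x α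
  set Q : ℝ := ρ ^ (n + 4) * ((r ^ 2 + ρ ^ 2) ^ 2)⁻¹ with hQ
  have hQ0 : 0 ≤ Q := by positivity
  suffices h : |r ^ n - ∑ ξ : Ξ, a ξ α * chord x ξ ^ n| ≤ (1 + K) * ((C₁ + C₂) * Q) by
    refine h.trans ?_
    calc _ ≤ (1 + |K|) * ((C₁ + C₂) * Q) := by gcongr
      _ = _ := by rw [hQ]; ring
  -- It suffices to subtract a function reproduced by the coefficients, leaving a small remainder.
  have hred : ∀ (P : SO3 → ℝ) (B : ℝ), 0 ≤ B → ∑ ξ : Ξ, a ξ α * P ξ = P α →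
      (∀ ξ, chord α ξ ≤ ρ / 2 → |chord x ξ ^ n - P ξ| ≤ B) →
      |r ^ n - ∑ ξ : Ξ, a ξ α * chord x ξ ^ n| ≤ (1 + K) * B := by
    intro P B hB hP hR
    have h1 := ha.abs_sum_le α (R := fun ξ => chord x ξ ^ n - P ξ)
      (fun ξ hξ => hR ξ (chord_le_of_rotDist_le hξ)) hB
    have h2 := hR α (by simp [chord_eq_dist]; positivity)
    have e : r ^ n - ∑ ξ : Ξ, a ξ α * chord x ξ ^ n =
        (r ^ n - P α) - ∑ ξ : Ξ, a ξ α * (chord x ξ ^ n - P ξ) := by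
      simp only [mul_sub, Finset.sum_sub_distrib, hP]
      ring
    rw [e]
    refine (abs_sub _ _).trans ?_
    linarith
  rcases lt_or_ge r (2 * ρ) with hcase | hcase
  · have hB : C₂ * Q ≤ (C₁ + C₂) * Q := by nlinarith [mul_nonneg hC₁ hQ0]
    refine (hred (fun _ => 0) ((3 * ρ) ^ n) (by positivity) (by simp) fun ξ hξ => ?_).trans
      (mul_le_mul_of_nonneg_left (le_trans ?_ hB) hK)
    · rw [sub_zero, abs_of_nonneg (pow_nonneg (chord_nonneg _ _) _)]
      refine pow_le_pow_left₀ (chord_nonneg _ _) ?_ n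
      linarith [chord_triangle x α ξ]
    · have h1 : (r ^ 2 + ρ ^ 2) ^ 2 ≤ 25 * ρ ^ 4 := by
        have : r ^ 2 + ρ ^ 2 ≤ 5 * ρ ^ 2 := by nlinarith
        calc _ ≤ (5 * ρ ^ 2) ^ 2 := pow_le_pow_left₀ (by positivity) this 2
          _ = _ := by ring
      rw [hQ, ← mul_assoc, ← div_eq_mul_inv, le_div_iff₀ (by positivity)]
      calc _ ≤ (3 * ρ) ^ n * (25 * ρ ^ 4) := by gcongr
        _ = _ := by rw [mul_pow]; ring
  · have hrpos : 0 < r := by linarith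
    have hB : C₁ * Q ≤ (C₁ + C₂) * Q := by nlinarith [mul_nonneg hC₂ hQ0]
    let P : SO3 → ℝ := fun ξ =>
      r ^ n * ∑ k ∈ Finset.range (2 * m + 1), c k * (-1 + (r ^ 2)⁻¹ * chord x ξ ^ 2) ^ k
    have hP : ∑ ξ : Ξ, a ξ α * P ξ = P α := by
      have h1 := ha.precision _ (polynomials_mono hL (sum_chord_sq_pow_mem x (-1)
        (((r ^ 2)⁻¹ : ℝ) : ℂ) ((r ^ n : ℝ) : ℂ) (fun k => (c k : ℂ)) (2 * m))) α
      have h2 : ((∑ ξ : Ξ, a ξ α * P ξ : ℝ) : ℂ) = ((P α : ℝ) : ℂ) := by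
        simp only [P]
        push_cast at h1 ⊢
        exact h1
      exact_mod_cast h2
    refine (hred P (r ^ n * (C₀ * (9 / 8 * (ρ / r)) ^ (n + 4))) (by positivity) hP
      fun ξ hξ => ?_).trans (mul_le_mul_of_nonneg_left (le_trans ?_ hB) hK)
    · set t := chord x ξ with ht
      have ht0 : 0 ≤ t := chord_nonneg x ξ
      set z : ℝ := -1 + (r ^ 2)⁻¹ * t ^ 2 with hz
      have hzr : z = (t - r) * (t + r) / r ^ 2 := by
        rw [hz]
        field_simp
        ring
      have htr : |t - r| ≤ ρ / 2 := by
        have h1 := chord_triangle x α ξ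
        have h2 := chord_triangle x ξ α
        rw [chord_comm ξ α] at h2
        exact abs_le.2 ⟨by linarith, by linarith⟩
      have hz1 : |z| ≤ 9 / 8 * (ρ / r) := by
        have h3 : t + r ≤ 9 / 4 * r := by linarith [(abs_le.1 htr).2]
        rw [hzr, abs_div, abs_mul, abs_of_nonneg (show 0 ≤ t + r by positivity),
          abs_of_nonneg (show 0 ≤ r ^ 2 by positivity), div_le_iff₀ (by positivity)]
        calc _ ≤ ρ / 2 * (9 / 4 * r) := by gcongr
          _ = _ := by field_simp; ring
      have hz2 : |z| < 3 / 4 := by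
        have : ρ / r ≤ 1 / 2 := by
          rw [div_le_iff₀ hrpos]
          linarith
        linarith
      have h1z : 1 + z = (t / r) ^ 2 := by
        rw [hz]
        field_simp
        ring
      have e : t ^ n = r ^ n * (1 + z) ^ ((n : ℝ) / 2) := by
        rw [h1z, ← Real.rpow_natCast (t / r) 2, ← Real.rpow_mul (by positivity)]
        rw [show ((2 : ℕ) : ℝ) * ((n : ℝ) / 2) = n by push_cast; ring, Real.rpow_natCast, div_pow]
        field_simp
      have hmain := happ z hz2
      rw [e]
      simp only [P]
      rw [← ht, ← hz, ← mul_sub, abs_mul, abs_of_nonneg (show 0 ≤ r ^ n by positivity)]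
      refine mul_le_mul_of_nonneg_left (hmain.trans ?_) (by positivity)
      rw [hn4]
      gcongr
    · have h1 : (r ^ 2 + ρ ^ 2) ^ 2 ≤ 25 / 16 * r ^ 4 := by
        have : r ^ 2 + ρ ^ 2 ≤ 5 / 4 * r ^ 2 := by nlinarith
        calc _ ≤ (5 / 4 * r ^ 2) ^ 2 := pow_le_pow_left₀ (by positivity) this 2
          _ = _ := by ring
      rw [hQ, ← mul_assoc C₁, ← div_eq_mul_inv, le_div_iff₀ (by positivity)]
      calc _ ≤ r ^ n * (C₀ * (9 / 8 * (ρ / r)) ^ (n + 4)) * (25 / 16 * r ^ 4) := by gcongr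
        _ = C₁ * ρ ^ (n + 4) * (r ^ (n + 4) / r ^ (n + 4)) := by
            simp only [C₁]
            rw [mul_pow, div_pow, pow_add r n 4]
            ring
        _ = _ := by rw [div_self (by positivity), mul_one]

/-! ### Young's inequality -/

theorem lintegral_inv_mul_right (b : SO3 → ℝ≥0∞) (x : SO3) :
    ∫⁻ α, b (α⁻¹ * x) ∂μ = ∫⁻ y, b y ∂μ := by
  rw [lintegral_inv_eq_self (fun α => b (α * x)), lintegral_mul_right_eq_self b x]

/-- Young's inequality for convolution with a nonnegative integrable function. -/
theorem eLpNorm_le_of_enorm_le_convolution {p : ℝ≥0∞} (hp : 1 ≤ p) {v F : SO3 → ℂ}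
    (hv : AEStronglyMeasurable v μ) {b : SO3 → ℝ≥0∞} (hb : Measurable b)
    (h : ∀ᵐ x ∂μ, ‖F x‖ₑ ≤ ∫⁻ α, b (α⁻¹ * x) * ‖v α‖ₑ ∂μ) :
    eLpNorm F p μ ≤ (∫⁻ y, b y ∂μ) * eLpNorm v p μ := by
  have hbx : ∀ x, Measurable fun α : SO3 => b (α⁻¹ * x) := fun x =>
    hb.comp (measurable_inv.mul_const x)
  by_cases hpt : p = ∞
  · subst hpt
    simp only [eLpNorm_exponent_top]
    refine eLpNormEssSup_le_of_ae_enorm_bound (h.mono fun x hx => hx.trans ?_)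
    calc _ ≤ ∫⁻ α, b (α⁻¹ * x) * eLpNormEssSup v μ ∂μ :=
          lintegral_mono_ae ((enorm_ae_le_eLpNormEssSup v μ).mono fun α hα => by gcongr)
      _ = _ := by rw [lintegral_mul_const _ (hbx x), lintegral_inv_mul_right]
  · set B := ∫⁻ y, b y ∂μ with hB
    have hq : 1 ≤ p.toReal := by
      rw [← ENNReal.toReal_one]
      exact ENNReal.toReal_mono hpt hp
    have hq0 : 0 < p.toReal := by linarith
    have hp0 : p ≠ 0 := (zero_lt_one.trans_le hp).ne'
    -- Jensen's inequality for the measure with density `α ↦ b (α⁻¹ x)`, of total mass `B`.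
    have hJ : ∀ x, (∫⁻ α, b (α⁻¹ * x) * ‖v α‖ₑ ∂μ) ^ p.toReal ≤
        B ^ (p.toReal - 1) * ∫⁻ α, b (α⁻¹ * x) * ‖v α‖ₑ ^ p.toReal ∂μ := by
      intro x
      set ν := μ.withDensity fun α => b (α⁻¹ * x) with hν
      have hvν : AEStronglyMeasurable v ν := hv.mono_ac (withDensity_absolutelyContinuous _ _)
      have h1 := eLpNorm_le_eLpNorm_mul_rpow_measure_univ (μ := ν) hp hvν
      have hu : ν Set.univ = B := by
        rw [hν, withDensity_apply _ MeasurableSet.univ, Measure.restrict_univ,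
          lintegral_inv_mul_right]
      rw [eLpNorm_one_eq_lintegral_enorm, eLpNorm_eq_lintegral_rpow_enorm_toReal hp0 hpt, hu,
        ENNReal.toReal_one, hν, lintegral_withDensity_eq_lintegral_mul₀ (hbx x).aemeasurable
          hv.enorm, lintegral_withDensity_eq_lintegral_mul₀ (hbx x).aemeasurable
          (hv.enorm.pow_const _)] at h1
      have h2 := ENNReal.rpow_le_rpow h1 hq0.le
      rw [ENNReal.mul_rpow_of_nonneg _ _ hq0.le, ← ENNReal.rpow_mul, ← ENNReal.rpow_mul,
        one_div_mul_cancel hq0.ne', ENNReal.rpow_one,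
        mul_comm (∫⁻ _, _ ∂_),
        show (1 / 1 - 1 / p.toReal) * p.toReal = p.toReal - 1 by field_simp] at h2
      exact h2
    rw [eLpNorm_eq_lintegral_rpow_enorm_toReal hp0 hpt,
      eLpNorm_eq_lintegral_rpow_enorm_toReal hp0 hpt]
    have hmeas : AEMeasurable (Function.uncurry fun x α : SO3 =>
        b (α⁻¹ * x) * ‖v α‖ₑ ^ p.toReal) (μ.prod μ) :=
      (hb.comp (measurable_snd.inv.mul measurable_fst)).aemeasurable.mul
        ((hv.enorm.comp_quasiMeasurePreserving Measure.quasiMeasurePreserving_snd).pow_const _)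
    have hmeas' : AEMeasurable (fun x => ∫⁻ α, b (α⁻¹ * x) * ‖v α‖ₑ ^ p.toReal ∂μ) μ :=
      hmeas.lintegral_prod_right'
    have key : ∫⁻ x, ‖F x‖ₑ ^ p.toReal ∂μ ≤ B ^ p.toReal * ∫⁻ α, ‖v α‖ₑ ^ p.toReal ∂μ := by
      calc _ ≤ ∫⁻ x, B ^ (p.toReal - 1) * ∫⁻ α, b (α⁻¹ * x) * ‖v α‖ₑ ^ p.toReal ∂μ ∂μ :=
            lintegral_mono_ae (h.mono fun x hx =>
              (ENNReal.rpow_le_rpow hx hq0.le).trans (hJ x))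
        _ = B ^ (p.toReal - 1) * ∫⁻ α, ∫⁻ x, b (α⁻¹ * x) * ‖v α‖ₑ ^ p.toReal ∂μ ∂μ := by
            rw [lintegral_const_mul'' _ hmeas', lintegral_lintegral_swap hmeas]
        _ = B ^ (p.toReal - 1) * ∫⁻ α, B * ‖v α‖ₑ ^ p.toReal ∂μ := by
            congr 1
            refine lintegral_congr fun α => ?_
            have hbα : Measurable fun x => b (α⁻¹ * x) := hb.comp (measurable_const_mul _)
            rw [lintegral_mul_const _ hbα, lintegral_mul_left_eq_self b]
        _ = _ := by
            rw [lintegral_const_mul'' _ (hv.enorm.pow_const _), ← mul_assoc]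
            congr 1
            nth_rewrite 2 [← ENNReal.rpow_one B]
            rw [← ENNReal.rpow_add_of_nonneg _ _ (by linarith) zero_le_one]
            congr 1
            ring
    calc _ ≤ (B ^ p.toReal * ∫⁻ α, ‖v α‖ₑ ^ p.toReal ∂μ) ^ (1 / p.toReal) :=
          ENNReal.rpow_le_rpow key (by positivity)
      _ = _ := by
          rw [ENNReal.mul_rpow_of_nonneg _ _ (by positivity), ← ENNReal.rpow_mul,
            mul_one_div_cancel hq0.ne', ENNReal.rpow_one]

/-! ### The approximation scheme on Sobolev and Besov spaces -/

theorem continuous_approximant (m : ℕ) (Ξ : Finset SO3) (a : Ξ → SO3 → ℝ) (g : SO3 → ℂ) :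
    Continuous (approximant m Ξ a g) := by
  have h (ξ : SO3) : Continuous fun x : SO3 => (kernel m x ξ : ℂ) := by
    simp only [kernel_eq]
    exact (continuous_ofReal_splineProfile m).comp (continuous_const_mul ξ⁻¹)
  unfold approximant
  exact continuous_finsetSum _ fun ξ _ => Continuous.mul continuous_const (h ξ)

/-- The error of the scheme on `g` is the image of `𝓛_m g` under the error kernel. -/
theorem sub_approximant_ae_eq {m : ℕ} (hm : 2 ≤ m) {Ξ : Finset SO3} {a : Ξ → SO3 → ℝ} {ρ K : ℝ}
    {L : ℕ} (ha : CoefficientKernel Ξ a ρ L K) {g : SO3 → ℂ} (hg : Integrable g μ)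
    (hv : Integrable (weakL m g) μ) (hw : IsWeakL m g (weakL m g)) :
    (fun x => g x - approximant m Ξ a g x) =ᵐ[μ] fun x => ∫ α, weakL m g α *
      ((kernel m x α - ∑ ξ : Ξ, a ξ α * kernel m x ξ : ℝ) : ℂ) ∂μ := by
  have hai : ∀ ξ : Ξ, Integrable (fun α => weakL m g α * (a ξ α : ℂ)) μ := fun ξ =>
    hv.mul_bdd (Complex.measurable_ofReal.comp (ha.measurable ξ)).aestronglyMeasurable
      (c := K) (ae_of_all _ fun α => by
        rw [Complex.norm_real, Real.norm_eq_abs]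
        exact (Finset.single_le_sum (f := fun ξ : Ξ => |a ξ α|) (fun _ _ => abs_nonneg _)
          (Finset.mem_univ ξ)).trans (ha.stability α))
  filter_upwards [ae_eq_integral_kernel hm hg hv hw] with x hx
  have hki : Integrable (fun α => weakL m g α * (kernel m x α : ℂ)) μ :=
    hv.mul_bdd ((continuous_kernel m).comp
      (continuous_const.prodMk continuous_id)).aestronglyMeasurable
      (ae_of_all _ fun α => norm_kernel_le m x α)
  have e : ∀ α, weakL m g α * ((kernel m x α - ∑ ξ : Ξ, a ξ α * kernel m x ξ : ℝ) : ℂ) =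
      weakL m g α * (kernel m x α : ℂ) -
        ∑ ξ : Ξ, weakL m g α * (a ξ α : ℂ) * (kernel m x ξ : ℂ) := fun α => by
    push_cast
    rw [mul_sub, Finset.mul_sum]
    simp only [mul_assoc]
  simp only [e]
  rw [integral_sub hki (integrable_finsetSum _ fun ξ _ => (hai ξ).mul_const _),
    integral_finsetSum _ fun ξ _ => (hai ξ).mul_const _, hx]
  simp only [integral_mul_const, approximant]

/-- The scheme approximates functions in `W_p^{2m}` to order `ρ ^ (2m)`. -/
theorem exists_eLpNorm_sub_approximant_le {m : ℕ} (hm : 2 ≤ m) (K : ℝ) : ∃ C : ℝ, 0 ≤ C ∧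
    ∀ (Ξ : Finset SO3) (a : Ξ → SO3 → ℝ) (ρ : ℝ) (L : ℕ), 0 < ρ → 2 * m ≤ L →
      CoefficientKernel Ξ a ρ L K → ∀ (p : ℝ≥0∞), 1 ≤ p → ∀ g, MemW p (2 * m) g →
        eLpNorm (fun x => g x - approximant m Ξ a g x) p μ ≤
          ENNReal.ofReal (C * ρ ^ (2 * m)) * normW p (2 * m) g := by
  obtain ⟨C₁, hC₁, h₁⟩ := exists_errorKernel_le hm K
  obtain ⟨C₂, hC₂, h₂⟩ := exists_eLpNorm_weakL_le m
  refine ⟨C₁ * (2 * Real.pi) * C₂, by positivity, fun Ξ a ρ L hρ hL ha p hp g hg => ?_⟩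
  obtain ⟨hv, hw, hn⟩ := h₂ p hp g hg
  set D : ℝ := C₁ * ρ ^ (2 * m + 1)
  have hD : 0 ≤ D := by positivity
  let b : SO3 → ℝ≥0∞ := fun y => ENNReal.ofReal (D * ((sinSq y + ρ ^ 2) ^ 2)⁻¹)
  have hb : Measurable b :=
    ((((measurable_sinSq.add_const _).pow_const 2).inv).const_mul D).ennreal_ofReal
  have hB : ∫⁻ y, b y ∂μ ≤ ENNReal.ofReal (C₁ * (2 * Real.pi) * ρ ^ (2 * m)) := by
    have hs : Measurable fun y => ENNReal.ofReal ((sinSq y + ρ ^ 2) ^ 2)⁻¹ :=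
      (((measurable_sinSq.add_const _).pow_const 2).inv).ennreal_ofReal
    simp only [b, ENNReal.ofReal_mul hD]
    rw [lintegral_const_mul _ hs]
    refine (mul_le_mul_right (lintegral_inv_sinSq_add_sq_le hρ) _).trans (le_of_eq ?_)
    rw [← ENNReal.ofReal_mul hD]
    congr 1
    simp only [D]
    field_simp
    ring
  calc _ ≤ (∫⁻ y, b y ∂μ) * eLpNorm (weakL m g) p μ := by
        refine eLpNorm_le_of_enorm_le_convolution hp hv.aestronglyMeasurable hb ?_
        filter_upwards [sub_approximant_ae_eq hm ha (hg.integrable hp) hv hw] with x hx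
        rw [hx]
        refine (enorm_integral_le_lintegral_enorm _).trans (lintegral_mono fun α => ?_)
        rw [enorm_mul, mul_comm]
        refine mul_le_mul_left ?_ _
        rw [← ofReal_norm, Complex.norm_real, Real.norm_eq_abs]
        exact ENNReal.ofReal_le_ofReal (h₁ Ξ a ρ L hρ hL ha x α)
    _ ≤ ENNReal.ofReal (C₁ * (2 * Real.pi) * ρ ^ (2 * m)) *
        (ENNReal.ofReal C₂ * normW p (2 * m) g) := mul_le_mul' hB hn
    _ = _ := by
        rw [← mul_assoc, ← ENNReal.ofReal_mul (by positivity)]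
        congr 2
        ring

theorem memW_zero (p : ℝ≥0∞) (k : ℕ) : MemW p k 0 := by
  rw [MemW]
  split_ifs
  · exact IsCk.const 0
  · exact ⟨MemLp.zero, fun w _ => ⟨0, MemLp.zero, fun φ _ => by simp⟩⟩

theorem normW_zero {p : ℝ≥0∞} (hp : 1 ≤ p) (k : ℕ) : normW p k 0 = 0 := by
  by_cases hpt : p = ∞
  · have h : ∀ w : List (Fin 3), XWord w 0 = 0 := fun w => by
      induction w with
      | nil => rfl
      | cons i w ih =>
        change X i (XWord w 0) = 0
        rw [ih, X_zero]
    simp [normW, hpt, h]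
  · have hp0 : 0 < p.toReal := ENNReal.toReal_pos (zero_lt_one.trans_le hp).ne' hpt
    have h : ∀ w : List (Fin 3), eLpNorm (weakDeriv w 0) p μ = 0 := fun w => by
      rw [eLpNorm_congr_ae (weakDeriv_ae_eq (u := 0) (integrable_zero _ _ _)
        fun φ _ => by simp), eLpNorm_zero]
    rw [normW, if_neg hpt]
    simp [h, hp0]

theorem MemBase.aestronglyMeasurable {p : ℝ≥0∞} {f : SO3 → ℂ} (hf : MemBase p f) :
    AEStronglyMeasurable f μ := by
  rw [MemBase] at hf
  split_ifs at hf
  · exact hf.aestronglyMeasurable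
  · exact hf.1

theorem kFunctional_le (m : ℕ) (s : ℝ) (p : ℝ≥0∞) (f : SO3 → ℂ) {ρ : ℝ} (hρ : 0 < ρ) :
    kFunctional p (2 * m) f ρ ≤ ENNReal.ofReal (ρ ^ s) * normB m s p f := by
  have h : ENNReal.ofReal (ρ ^ (-s)) * kFunctional p (2 * m) f ρ ≤ normB m s p f :=
    le_iSup₂_of_le (f := fun (t : ℝ) (_ : 0 < t) =>
      ENNReal.ofReal (t ^ (-s)) * kFunctional p (2 * m) f t) ρ hρ le_rfl
  calc _ = ENNReal.ofReal (ρ ^ s) * (ENNReal.ofReal (ρ ^ (-s)) * kFunctional p (2 * m) f ρ) := by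
        rw [← mul_assoc, ← ENNReal.ofReal_mul (by positivity), ← Real.rpow_add hρ, add_neg_cancel,
          Real.rpow_zero, ENNReal.ofReal_one, one_mul]
    _ ≤ _ := mul_le_mul_right h _

theorem eLpNorm_eq_zero_of_kFunctional_eq_zero {p : ℝ≥0∞} (hp : 1 ≤ p) {k : ℕ} {f : SO3 → ℂ}
    (hf : AEStronglyMeasurable f μ) {ρ : ℝ} (hρ : 0 < ρ) (h : kFunctional p k f ρ = 0) :
    eLpNorm f p μ = 0 := by
  set A : ℝ≥0∞ := 1 + (ENNReal.ofReal (ρ ^ k))⁻¹ with hA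
  have hk : ENNReal.ofReal (ρ ^ k) ≠ 0 := by simp [hρ]
  have hAt : A ≠ ∞ := by simp [hA, hρ]
  have hle : eLpNorm f p μ / A ≤ kFunctional p k f ρ := by
    refine le_iInf₂ fun g hg => ENNReal.div_le_of_le_mul ?_
    have hgm := (hg.integrable hp).aestronglyMeasurable
    calc eLpNorm f p μ = eLpNorm ((fun x => f x - g x) + g) p μ := by
          congr 1
          funext x
          simp
      _ ≤ eLpNorm (fun x => f x - g x) p μ + eLpNorm g p μ :=
          eLpNorm_add_le (hf.sub hgm) hgm hp
      _ ≤ eLpNorm (fun x => f x - g x) p μ + normW p k g := by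
          gcongr
          exact hg.eLpNorm_le hp
      _ = eLpNorm (fun x => f x - g x) p μ +
          ENNReal.ofReal (ρ ^ k) * normW p k g * (ENNReal.ofReal (ρ ^ k))⁻¹ := by
          rw [mul_right_comm, ENNReal.mul_inv_cancel hk ENNReal.ofReal_ne_top, one_mul]
      _ ≤ (eLpNorm (fun x => f x - g x) p μ + ENNReal.ofReal (ρ ^ k) * normW p k g) * A := by
          rw [hA, mul_add, mul_one]
          gcongr
          · exact le_self_add
          · exact le_add_self
  rw [h, nonpos_iff_eq_zero, ENNReal.div_eq_zero_iff] at hle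
  exact hle.resolve_right hAt

theorem exists_isSmoothPart {m : ℕ} {s : ℝ} {p : ℝ≥0∞} (hp : 1 ≤ p) {ρ : ℝ} (hρ : 0 < ρ)
    {f : SO3 → ℂ} (hf : MemB m s p f) : ∃ g, IsSmoothPart m s p ρ f g := by
  have hK := kFunctional_le m s p f hρ
  by_cases hN : normB m s p f = 0
  · -- If the Besov norm vanishes, the infimum need not be nearly attained, but `f = 0`.
    rw [hN, mul_zero, nonpos_iff_eq_zero] at hK
    have h0 := eLpNorm_eq_zero_of_kFunctional_eq_zero hp hf.1.aestronglyMeasurable hρ hK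
    exact ⟨0, memW_zero _ _, by simp [normW_zero hp], by simp [h0]⟩
  · have hpos : 0 < ENNReal.ofReal (ρ ^ s) * normB m s p f :=
      ENNReal.mul_pos (by simp [Real.rpow_pos_of_pos hρ]) hN
    have hfin : ENNReal.ofReal (ρ ^ s) * normB m s p f ≠ ∞ :=
      ENNReal.mul_ne_top ENNReal.ofReal_ne_top hf.2.ne
    have hlt : kFunctional p (2 * m) f ρ < ENNReal.ofReal (2 * ρ ^ s) * normB m s p f := by
      refine hK.trans_lt ?_
      rw [ENNReal.ofReal_mul zero_le_two, mul_assoc, ENNReal.ofReal_ofNat, two_mul]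
      exact ENNReal.lt_add_right hfin hpos.ne'
    simp only [kFunctional, iInf_lt_iff] at hlt
    obtain ⟨g, hg, hlt⟩ := hlt
    refine ⟨g, hg, ?_, le_self_add.trans hlt.le⟩
    have h1 : ENNReal.ofReal (ρ ^ (2 * m)) * normW p (2 * m) g ≤
        ENNReal.ofReal (2 * ρ ^ s) * normB m s p f := le_add_self.trans hlt.le
    have e1 : ρ ^ (-(2 * (m : ℝ))) * ρ ^ (2 * m) = 1 := by
      rw [← Real.rpow_natCast ρ (2 * m), ← Real.rpow_add hρ]
      simp
    have e2 : ρ ^ (-(2 * (m : ℝ))) * (2 * ρ ^ s) = 2 * ρ ^ (s - 2 * (m : ℝ)) := by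
      rw [sub_eq_add_neg, Real.rpow_add hρ]
      ring
    calc normW p (2 * m) g = ENNReal.ofReal (ρ ^ (-(2 * (m : ℝ)))) *
          (ENNReal.ofReal (ρ ^ (2 * m)) * normW p (2 * m) g) := by
          rw [← mul_assoc, ← ENNReal.ofReal_mul (by positivity), e1, ENNReal.ofReal_one, one_mul]
      _ ≤ ENNReal.ofReal (ρ ^ (-(2 * (m : ℝ)))) *
          (ENNReal.ofReal (2 * ρ ^ s) * normB m s p f) := mul_le_mul_right h1 _
      _ = _ := by rw [← mul_assoc, ← ENNReal.ofReal_mul (by positivity), e2]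

end SurfaceSpline

theorem theorem5p2 (m : ℕ) (hm : 2 ≤ m) (L : ℕ) (hL : 2 * m ≤ L) (K : ℝ) :
    ∃ C : ℝ, 0 < C ∧
      ∀ (s : ℝ), 0 < s → s < 2 * (m : ℝ) →
      ∀ (p : ENNReal), 1 ≤ p →
      ∀ (Ξ : Finset SurfaceSpline.SO3) (a : Ξ → SurfaceSpline.SO3 → ℝ) (ρ : ℝ), 0 < ρ →
        SurfaceSpline.CoefficientKernel Ξ a ρ L K →
      ∀ f : SurfaceSpline.SO3 → ℂ, SurfaceSpline.MemB m s p f →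
        (∃ g, SurfaceSpline.IsSmoothPart m s p ρ f g) ∧
        ∀ g, SurfaceSpline.IsSmoothPart m s p ρ f g →
          MeasureTheory.eLpNorm (fun x => f x - SurfaceSpline.approximant m Ξ a g x) p
              SurfaceSpline.μ ≤
            ENNReal.ofReal (C * ρ ^ s) * SurfaceSpline.normB m s p f := by
  obtain ⟨C, hC, h⟩ := SurfaceSpline.exists_eLpNorm_sub_approximant_le hm K
  refine ⟨2 + C * 2, by positivity, fun s _ _ p hp Ξ a ρ hρ ha f hf =>
    ⟨SurfaceSpline.exists_isSmoothPart hp hρ hf, fun g hg => ?_⟩⟩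
  have hgm := (hg.mem.integrable hp).aestronglyMeasurable
  have hTm := (SurfaceSpline.continuous_approximant m Ξ a g).aestronglyMeasurable
    (μ := SurfaceSpline.μ)
  have e : C * ρ ^ (2 * m) * (2 * ρ ^ (s - 2 * (m : ℝ))) = C * 2 * ρ ^ s := by
    have : ρ ^ s = ρ ^ (2 * m) * ρ ^ (s - 2 * (m : ℝ)) := by
      rw [← Real.rpow_natCast ρ (2 * m), ← Real.rpow_add hρ]
      congr 1
      push_cast
      ring
    rw [this]
    ring
  set N := SurfaceSpline.normB m s p f
  calc _ = eLpNorm ((fun x => f x - g x) + fun x => g x - SurfaceSpline.approximant m Ξ a g x) p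
        SurfaceSpline.μ := by
        congr 1
        funext x
        simp
    _ ≤ eLpNorm (fun x => f x - g x) p SurfaceSpline.μ +
        eLpNorm (fun x => g x - SurfaceSpline.approximant m Ξ a g x) p SurfaceSpline.μ :=
        eLpNorm_add_le (hf.1.aestronglyMeasurable.sub hgm) (hgm.sub hTm) hp
    _ ≤ ENNReal.ofReal (2 * ρ ^ s) * N + ENNReal.ofReal (C * ρ ^ (2 * m)) *
        (ENNReal.ofReal (2 * ρ ^ (s - 2 * (m : ℝ))) * N) :=
        add_le_add hg.norm_sub_le ((h Ξ a ρ L hρ hL ha p hp g hg.mem).trans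
          (mul_le_mul_right hg.normW_le _))
    _ = ENNReal.ofReal ((2 + C * 2) * ρ ^ s) * N := by
        rw [← mul_assoc, ← ENNReal.ofReal_mul (by positivity), e, ← add_mul,
          ← ENNReal.ofReal_add (by positivity) (by positivity), ← add_mul]
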